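/- **Model.** Write $\mathbb N=\{1,2,\dots\}$. Let $f:\{0,1,2,\dots\}\to(0,\infty)$ and let $(m_i)_{i\ge1}$ be a (possibly random) $\mathbb N$-valued sequence; put $s_0=0$ and $s_n=m_1+\dots+m_n$. Random directed multigraphs $\mathcal G_0,\mathcal G_1,\dots$ are built as follows, conditionally on the realization of the whole sequence $(m_i)_{i\ge1}$. $\mathcal G_0$ has the single vertex $v_0$ and no edges. $\mathcal G_n$ arises from $\mathcal G_{n-1}$ by adding a vertex $v_n$ and $m_n$ edges $e_k$, $s_{n-1}<k\le s_n$, directed away from $v_n$, whose other ends are chosen one after the other: given the attachment sequence and the edges $e_1,\dots,e_{k-1}$, the other end of $e_k$ is $v_i$ ($0\le i\le n-1$) with probability $$\frac{f(d_i(k-1))}{\sum_{j=0}^{n-1}f(d_j(k-1))},$$ where $d_j(k-1)$ is the degree (in-degree plus out-degree) of $v_j$ in the graph with edges $e_1,\dots,e_{k-1}$. For $k=1,2$ and $l\ge0$ let $\Phi_k(l)=\sum_{i=0}^{l-1}f(i)^{-k}$, and $\Phi_2(\infty)=\lim_{l\to\infty}\Phi_2(l)$. **Statement.** Assume that $f$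 is non-decreasing, that there is a constant $C_f>0$ with $f(i)\le C_f(i+1)$ for all $i\ge0$, that $\Phi_2(\infty)<\infty$, and that almost surely $$\limsup_{n\to\infty}\frac{\Phi_1(m_n)}{\log s_n}\le\frac1{8C_f}.$$ Then for every integer $K\ge0$ there is a (measurable) random variable $n_K^*$ with values in $\{0,1,2,\dots\}$ such that almost surely there is a set $S$ of $K$ vertices with the following properties. 1. For all $n\ge n_K^*$, $S$ is the set of the $K$ vertices of highest degree in $\mathcal G_n$, uniquely so: $S$ is contained in $\{v_0,\dots,v_n\}$, and each vertex in $S$ has strictly larger degree in $\mathcal G_n$ than each vertex of $\mathcal G_n$ outside $S$. 2. For all $n\ge n_K^*$, the degrees in $\mathcal G_n$ of the vertices in $S$ are pairwise distinct. 3. The order of the vertices in $S$ by their degree in $\mathcal G_n$ is the same for all $n\ge n_K^*$. -/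

import Mathlib

open MeasureTheory ProbabilityTheory Filter Topology

namespace PrefAttach

/-- `Phi f k l = ∑_{i=0}^{l-1} 1 / f(i)^k`. -/
noncomputable def Phi (f : ℕ → ℝ) (k l : ℕ) : ℝ :=
  ∑ i ∈ Finset.range l, 1 / f i ^ k

/-- `edgeTotal m n = m₁ + ⋯ + mₙ`, the number of edges brought by the vertices `v₁, …, vₙ`
(the value `m 0` is never used). -/
def edgeTotal (m : ℕ → ℕ) (n : ℕ) : ℕ :=
  ∑ i ∈ Finset.Icc 1 n, m i

/-- The source of the `k`-th edge (`k ≥ 1`): the edge `e_k` is brought by the vertex `v_n`, where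
`n` is the index with `m₁ + ⋯ + m_{n-1} < k ≤ m₁ + ⋯ + m_n`. -/
noncomputable def source (m : ℕ → ℕ) (k : ℕ) : ℕ :=
  sInf {n | k ≤ edgeTotal m n}

/-- The degree (out-degree plus in-degree) of the vertex `v_i` in the directed multigraph with the
edges `e_1, …, e_k`, where `e_l` leads from `v_{source m l}` to `v_{T l}`. -/
noncomputable def degree (m T : ℕ → ℕ) (k i : ℕ) : ℕ :=
  ((Finset.Icc 1 k).filter (fun l => source m l = i)).card +
    ((Finset.Icc 1 k).filter (fun l => T l = i)).card

/-- The degree of `v_i` in the graph `G_n`, which has the vertices `v_0, …, v_n` and the edges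
brought by `v_1, …, v_n`. -/
noncomputable def graphDegree (m T : ℕ → ℕ) (n i : ℕ) : ℕ :=
  degree m T (edgeTotal m n) i

/-- The probability that the `(k+1)`-st edge is attached to `v_i`, given the attachment sequence
and the targets of the first `k` edges. The vertices available as targets are those that are older
than the source of that edge. -/
noncomputable def attachProb (f : ℕ → ℝ) (m T : ℕ → ℕ) (k i : ℕ) : ℝ :=
  if i < source m (k + 1) then
    f (degree m T k i) / ∑ j ∈ Finset.range (source m (k + 1)), f (degree m T k j)
  else 0

/-- The σ-algebra generated by the whole attachment sequence `m₁, m₂, …` and by the targets of the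
first `k` edges. -/
abbrev history {Ω : Type*} (m T : ℕ → Ω → ℕ) (k : ℕ) : MeasurableSpace Ω :=
  (⨆ i ∈ Set.Ici (1 : ℕ), MeasurableSpace.comap (m i) ⊤) ⊔
    ⨆ l ∈ Set.Icc 1 k, MeasurableSpace.comap (T l) ⊤

/-- `m₁, m₂, …` is a random sequence of positive integers and `T₁, T₂, …` are the targets of the
successive edges of the generalized attachment model with attachment function `f` and attachment
sequence `m`. -/
structure IsAttachmentModel {Ω : Type*} [MeasurableSpace Ω] (P : Measure Ω)
    (f : ℕ → ℝ) (m T : ℕ → Ω → ℕ) : Prop where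
  measurable_attachment : ∀ i, 1 ≤ i → Measurable (m i)
  one_le_attachment : ∀ i, 1 ≤ i → ∀ ω, 1 ≤ m i ω
  measurable_target : ∀ l, 1 ≤ l → Measurable (T l)
  condProb_target : ∀ k i : ℕ,
    P[{ω | T (k + 1) ω = i}.indicator (fun _ => (1 : ℝ)) | history m T k]
      =ᵐ[P] fun ω => attachProb f (fun j => m j ω) (fun l => T l ω) k i

/-- `S` consists of `K` vertices of `G_n`, each with a degree strictly larger than that of every
vertex of `G_n` outside `S`: it is, without any ambiguity from ties, the set of the vertices with
the `K` largest degrees. -/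
def IsTopSet (m T : ℕ → ℕ) (n K : ℕ) (S : Finset ℕ) : Prop :=
  S ⊆ Finset.range (n + 1) ∧ S.card = K ∧
    ∀ i ∈ S, ∀ j ∈ Finset.range (n + 1) \ S, graphDegree m T n j < graphDegree m T n i

end PrefAttach

/-!
# Persistence of the vertices of highest degree

Fix the attachment sequence. While `v_i` and `v_j` receive in-edges, each step raises the degree
`x` of a vertex with probability `f x / s`, where the total weight `s` is common to all vertices.
Hence the expected growth of `Φ₁(x)` is `1 / s` for every vertex, and the differences
`Φ₁(d_i) - Φ₁(d_j)` are martingales, with a quadratic variation controlled by `Φ₂(∞) < ∞`. More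
generally, a function `g x y` of two degrees is a supermartingale as soon as
`f x (g (x+1) y - g x y) + f y (g x (y+1) - g x y) ≤ 0` (`supermartingale_pair`); all probabilistic
estimates come from explicit choices of `g`.

*Growth.* Since `f i ≤ C (i+1)`, the total weight after `k` edges is at most `3C(k+1)`, and a
product supermartingale gives `Φ₁(d_i) ≥ log k / (6C) - O(1)` (`ae_log_le_Phi_deg`). In
particular all degrees tend to infinity.

*Late vertices.* At its birth `v_n` has degree `m_n`, so `Φ₁` of it is at most about
`log s_n / (8C)`, well below the value for a fixed `v_i`. The martingale
`∏_{l<d_n} (1 + r/f(l)) ∏_{y₀≤l<d_i} (1 - r/f(l))` is then at most a negative power of `s_n`, as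
large as desired for large `r`, whereas it exceeds a positive constant when `v_n` catches up. The
maximal inequality and Borel-Cantelli show that almost surely only finitely many vertices ever catch
up with `v_i` (`ae_eventually_deg_lt`).

*Ties.* Let `D = Φ₁(d_i) - Φ₁(d_j)` and `V = ∑_{l≥d_i} 1/f(l)² + ∑_{l≥d_j} 1/f(l)²`. Then
`D² + V` is a nonnegative martingale, `D⁴ + 7D²V + 32V²` is a supermartingale that dominates its
square, and at a tie these are `V` and `32V²`. A second moment argument gives a
lower bound, independent of the past, for the probability that the limit of `D²` is not zero, in
which case there are only finitely many ties. Lévy's upward theorem excludes infinitely many ties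
(`ae_eventually_deg_ne`).

Between two vertices the order can change only through a tie, so it is eventually constant, and
the `K` highest degrees eventually belong to finitely many candidates; the rest is combinatorial
(`exists_isPersistentFrom`).
-/

namespace PrefAttach

/-! ### Degrees and edge counts of a fixed graph sequence -/

section Deterministic

variable {m T : ℕ → ℕ}

lemma edgeTotal_succ (m : ℕ → ℕ) (n : ℕ) : edgeTotal m (n + 1) = edgeTotal m n + m (n + 1) := by
  unfold edgeTotal
  rw [Finset.sum_Icc_succ_top (by omega)]

lemma edgeTotal_strictMono (hm : ∀ i, 1 ≤ i → 1 ≤ m i) : StrictMono (edgeTotal m) :=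
  strictMono_nat_of_lt_succ fun n => by
    have := hm (n + 1) (by omega)
    rw [edgeTotal_succ]
    omega

lemma le_edgeTotal (hm : ∀ i, 1 ≤ i → 1 ≤ m i) (n : ℕ) : n ≤ edgeTotal m n :=
  (edgeTotal_strictMono hm).le_apply

lemma source_le_iff (hm : ∀ i, 1 ≤ i → 1 ≤ m i) {k n : ℕ} :
    source m k ≤ n ↔ k ≤ edgeTotal m n := by
  have hmem : source m k ∈ {n | k ≤ edgeTotal m n} := Nat.sInf_mem ⟨k, le_edgeTotal hm k⟩
  exact ⟨fun h => le_trans hmem ((edgeTotal_strictMono hm).monotone h), fun h => Nat.sInf_le h⟩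

lemma lt_source_succ_iff (hm : ∀ i, 1 ≤ i → 1 ≤ m i) {k n : ℕ} :
    n < source m (k + 1) ↔ edgeTotal m n ≤ k := by
  rw [← not_le, source_le_iff hm]
  omega

lemma source_succ_le (hm : ∀ i, 1 ≤ i → 1 ≤ m i) (k : ℕ) : source m (k + 1) ≤ k + 1 :=
  (source_le_iff hm).2 (le_edgeTotal hm _)

lemma source_succ_pos (hm : ∀ i, 1 ≤ i → 1 ≤ m i) (k : ℕ) : 0 < source m (k + 1) := by
  rw [lt_source_succ_iff hm]
  simp [edgeTotal]

lemma degree_zero (m T : ℕ → ℕ) (i : ℕ) : degree m T 0 i = 0 := by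
  simp [degree]

lemma degree_succ (m T : ℕ → ℕ) (k i : ℕ) :
    degree m T (k + 1) i = degree m T k i + (if source m (k + 1) = i then 1 else 0) +
      (if T (k + 1) = i then 1 else 0) := by
  have h : Finset.Icc 1 (k + 1) = insert (k + 1) (Finset.Icc 1 k) := by
    ext x
    simp only [Finset.mem_Icc, Finset.mem_insert]
    omega
  unfold degree
  rw [h, Finset.filter_insert, Finset.filter_insert]
  split_ifs <;> simp <;> omega

lemma degree_mono (m T : ℕ → ℕ) (i : ℕ) : Monotone fun k => degree m T k i :=
  monotone_nat_of_le_succ fun k => by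
    rw [degree_succ]
    omega

lemma degree_le (m T : ℕ → ℕ) (k i : ℕ) : degree m T k i ≤ 2 * k := by
  induction k with
  | zero => simp [degree_zero]
  | succ k ih =>
    rw [degree_succ]
    split_ifs <;> omega

/-- Once `v_i` has brought all of its edges, its degree grows only through in-edges. -/
lemma degree_succ_of_edgeTotal_le (hm : ∀ i, 1 ≤ i → 1 ≤ m i) {k i : ℕ}
    (h : edgeTotal m i ≤ k) :
    degree m T (k + 1) i = degree m T k i + (if T (k + 1) = i then 1 else 0) := by
  rw [degree_succ, if_neg ((lt_source_succ_iff hm).2 h).ne', add_zero]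

lemma sum_degree_le (m T : ℕ → ℕ) (k n : ℕ) :
    ∑ j ∈ Finset.range n, degree m T k j ≤ 2 * k := by
  induction k with
  | zero => simp [degree_zero]
  | succ k ih =>
    simp only [degree_succ, Finset.sum_add_distrib, Finset.sum_ite_eq]
    split_ifs <;> omega

/-- The total weight of the vertices available to the edge `e_{k+1}`. -/
noncomputable def totalWeight (f : ℕ → ℝ) (m T : ℕ → ℕ) (k : ℕ) : ℝ :=
  ∑ j ∈ Finset.range (source m (k + 1)), f (degree m T k j)

lemma totalWeight_pos {f : ℕ → ℝ} (hf : ∀ i, 0 < f i) (hm : ∀ i, 1 ≤ i → 1 ≤ m i) (k : ℕ) :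
    0 < totalWeight f m T k :=
  Finset.sum_pos (fun _ _ => hf _) (by simpa using (source_succ_pos hm k).ne')

lemma totalWeight_le {f : ℕ → ℝ} {C : ℝ} (hC : 0 < C) (hf : ∀ i : ℕ, f i ≤ C * ((i : ℝ) + 1))
    (hm : ∀ i, 1 ≤ i → 1 ≤ m i) (k : ℕ) : totalWeight f m T k ≤ 3 * C * (k + 1) := by
  have h1 : ∑ j ∈ Finset.range (source m (k + 1)), ((degree m T k j : ℕ) : ℝ) ≤ 2 * k := by
    exact_mod_cast sum_degree_le m T k _
  have h2 : ((source m (k + 1) : ℕ) : ℝ) ≤ k + 1 := by exact_mod_cast source_succ_le hm k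
  calc totalWeight f m T k
      ≤ ∑ j ∈ Finset.range (source m (k + 1)), C * ((degree m T k j : ℝ) + 1) :=
        Finset.sum_le_sum fun _ _ => hf _
    _ = C * (∑ j ∈ Finset.range (source m (k + 1)), (degree m T k j : ℝ) + source m (k + 1)) := by
        rw [← Finset.mul_sum, Finset.sum_add_distrib]
        simp
    _ ≤ C * (3 * (k + 1)) := by
        gcongr
        have : (0 : ℝ) ≤ k := by positivity
        linarith
    _ = _ := by ring

/-- If every edge leads to an older vertex, then the degree of `v_n` at its birth is `m_n`. -/
lemma degree_edgeTotal_self (hm : ∀ i, 1 ≤ i → 1 ≤ m i) (hT : ∀ l, T (l + 1) < source m (l + 1))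
    {n : ℕ} (hn : 1 ≤ n) : degree m T (edgeTotal m n) n = m n := by
  obtain ⟨n, rfl⟩ : ∃ n', n = n' + 1 := ⟨n - 1, by omega⟩
  have hsrc : ∀ l, l ≤ edgeTotal m (n + 1) → source m l ≤ n + 1 := fun l hl =>
    (source_le_iff hm).2 hl
  have key : ∀ l ∈ Finset.Icc 1 (edgeTotal m (n + 1)),
      (source m l = n + 1 ↔ edgeTotal m n < l) := by
    intro l hl
    have h1 := hsrc l (Finset.mem_Icc.1 hl).2
    rw [← not_le, ← source_le_iff hm]
    omega
  have hT0 : (Finset.Icc 1 (edgeTotal m (n + 1))).filter (fun l => T l = n + 1) = ∅ := by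
    refine Finset.filter_eq_empty_iff.2 fun l hl => ?_
    rw [Finset.mem_Icc] at hl
    obtain ⟨l, rfl⟩ : ∃ l', l = l' + 1 := ⟨l - 1, by omega⟩
    have := hT l
    have := hsrc _ hl.2
    omega
  have hI : (Finset.Icc 1 (edgeTotal m (n + 1))).filter (fun l => edgeTotal m n < l) =
      Finset.Ioc (edgeTotal m n) (edgeTotal m (n + 1)) := by
    ext l
    simp only [Finset.mem_filter, Finset.mem_Icc, Finset.mem_Ioc]
    omega
  unfold degree
  rw [hT0, Finset.filter_congr key, hI, Nat.card_Ioc, edgeTotal_succ]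
  simp

end Deterministic

/-! ### Measurability with respect to the history -/

section Measurability

variable {Ω : Type*} {m T : ℕ → Ω → ℕ}

lemma history_mono (m T : ℕ → Ω → ℕ) : Monotone (history m T) := fun _ _ hkl =>
  sup_le_sup_left (biSup_mono fun _ hi => ⟨hi.1, hi.2.trans hkl⟩) _

lemma measurable_history_attachment (T : ℕ → Ω → ℕ) (k : ℕ) {i : ℕ} (hi : 1 ≤ i) :
    Measurable[history m T k] (m i) :=
  Measurable.mono (comap_measurable (m i))
    (le_sup_of_le_left (le_biSup (fun i => MeasurableSpace.comap (m i) ⊤) hi)) le_rfl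

lemma measurable_history_target (m : ℕ → Ω → ℕ) {k l : ℕ} (h1 : 1 ≤ l) (hl : l ≤ k) :
    Measurable[history m T k] (T l) :=
  Measurable.mono (comap_measurable (T l))
    (le_sup_of_le_right
      (le_biSup (fun l => MeasurableSpace.comap (T l) ⊤) (show l ∈ Set.Icc 1 k from ⟨h1, hl⟩)))
    le_rfl

lemma measurable_history_edgeTotal (m T : ℕ → Ω → ℕ) (k n : ℕ) :
    Measurable[history m T k] fun ω => edgeTotal (fun j => m j ω) n := by
  unfold edgeTotal
  exact Finset.measurable_sum _ fun i hi =>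
    measurable_history_attachment T k (Finset.mem_Icc.1 hi).1

lemma measurable_history_source (hm : ∀ i, 1 ≤ i → ∀ ω, 1 ≤ m i ω) (T : ℕ → Ω → ℕ) (k l : ℕ) :
    Measurable[history m T k] fun ω => source (fun j => m j ω) l := by
  refine measurable_of_Iic fun n => ?_
  have : (fun ω => source (fun j => m j ω) l) ⁻¹' Set.Iic n =
      (fun ω => edgeTotal (fun j => m j ω) n) ⁻¹' Set.Ici l := by
    ext ω
    exact source_le_iff fun i hi => hm i hi ω
  rw [this]
  exact measurable_history_edgeTotal m T k n (Set.to_countable _).measurableSet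

lemma measurable_history_degree (hm : ∀ i, 1 ≤ i → ∀ ω, 1 ≤ m i ω) (T : ℕ → Ω → ℕ) {k l : ℕ}
    (hl : l ≤ k) (i : ℕ) :
    Measurable[history m T k] fun ω => degree (fun j => m j ω) (fun l => T l ω) l i := by
  induction l with
  | zero =>
    simp only [degree_zero]
    exact measurable_const
  | succ l ih =>
    simp only [degree_succ]
    refine Measurable.add (Measurable.add (ih (by omega)) ?_) ?_
    · exact Measurable.ite (measurable_history_source hm T k (l + 1) (measurableSet_singleton i))
        measurable_const measurable_const
    · exact Measurable.ite
        (measurable_history_target m (Nat.succ_pos l) hl (measurableSet_singleton i))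
        measurable_const measurable_const

end Measurability

section Filtration

variable {Ω : Type*} [mΩ : MeasurableSpace Ω] {P : Measure Ω} {f : ℕ → ℝ} {m T : ℕ → Ω → ℕ}

namespace IsAttachmentModel

lemma history_le (h : IsAttachmentModel P f m T) (k : ℕ) : history m T k ≤ mΩ :=
  sup_le (iSup₂_le fun i hi => (h.measurable_attachment i hi).comap_le)
    (iSup₂_le fun l hl => (h.measurable_target l hl.1).comap_le)

/-- The filtration of the histories after `k₀, k₀ + 1, …` edges. -/
def filtration (h : IsAttachmentModel P f m T) (k₀ : ℕ) : Filtration ℕ mΩ where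
  seq n := history m T (k₀ + n)
  mono' _ _ hn := history_mono m T (by omega)
  le' _ := h.history_le _

lemma one_le (h : IsAttachmentModel P f m T) (ω : Ω) : ∀ i, 1 ≤ i → 1 ≤ m i ω :=
  fun i hi => h.one_le_attachment i hi ω

/-- Almost surely every edge leads to a vertex older than its source. -/
lemma ae_target_lt_source [IsProbabilityMeasure P] (h : IsAttachmentModel P f m T) :
    ∀ᵐ ω ∂P, ∀ l, T (l + 1) ω < source (fun j => m j ω) (l + 1) := by
  have key : ∀ l i : ℕ, ∀ᵐ ω ∂P,
      ¬ (T (l + 1) ω = i ∧ source (fun j => m j ω) (l + 1) ≤ i) := by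
    intro l i
    have hsrc : MeasurableSet[history m T l] {ω | source (fun j => m j ω) (l + 1) ≤ i} :=
      measurable_history_source h.one_le_attachment T l (l + 1)
        (Set.to_countable (Set.Iic i)).measurableSet
    have hTi : MeasurableSet {ω | T (l + 1) ω = i} :=
      h.measurable_target (l + 1) (by omega) (measurableSet_singleton i)
    have hint : Integrable ({ω | T (l + 1) ω = i}.indicator fun _ => (1 : ℝ)) P :=
      (integrable_const 1).indicator hTi
    have h1 := setIntegral_condExp (h.history_le l) hint hsrc
    rw [setIntegral_congr_ae ((h.history_le l) _ hsrc) (g := fun _ => 0)] at h1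
    · rw [integral_zero, integral_indicator_const _ hTi] at h1
      have h2 : P ({ω | T (l + 1) ω = i} ∩ {ω | source (fun j => m j ω) (l + 1) ≤ i}) = 0 := by
        have h3 := h1.symm
        rw [smul_eq_mul, mul_one, measureReal_restrict_apply hTi,
          measureReal_eq_zero_iff] at h3
        exact h3
      exact measure_eq_zero_iff_ae_notMem.1 h2
    · filter_upwards [h.condProb_target l i] with ω hω hωs
      rw [hω, attachProb, if_neg (not_lt.2 hωs)]
  filter_upwards [ae_all_iff.2 fun l => ae_all_iff.2 fun i => key l i] with ω hω l
  by_contra hcon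
  exact hω l _ ⟨rfl, not_lt.1 hcon⟩

end IsAttachmentModel

end Filtration

/-! ### Nonnegative supermartingales -/

section Supermartingale

variable {Ω : Type*} [mΩ : MeasurableSpace Ω] {P : Measure Ω} [IsProbabilityMeasure P]
  {𝓕 : Filtration ℕ mΩ} {X : ℕ → Ω → ℝ}

lemma ae_exists_tendsto_of_supermartingale (hX : Supermartingale X 𝓕 P)
    (hpos : ∀ n ω, 0 ≤ X n ω) :
    ∀ᵐ ω ∂P, ∃ x, Tendsto (fun n => X n ω) atTop (𝓝 x) := by
  have hbdd : ∀ n, eLpNorm ((-X) n) 1 P ≤ ((∫ ω, X 0 ω ∂P).toNNReal : ENNReal) := by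
    intro n
    have h1 : ∫ ω, X n ω ∂P ≤ ∫ ω, X 0 ω ∂P := by
      simpa using hX.setIntegral_le (Nat.zero_le n) MeasurableSet.univ
    rw [Pi.neg_apply, eLpNorm_neg, eLpNorm_one_eq_lintegral_enorm]
    calc ∫⁻ ω, ‖X n ω‖ₑ ∂P = ∫⁻ ω, ENNReal.ofReal (X n ω) ∂P := by
          refine lintegral_congr fun ω => ?_
          rw [Real.enorm_eq_ofReal (hpos n ω)]
      _ = ENNReal.ofReal (∫ ω, X n ω ∂P) :=
          (ofReal_integral_eq_lintegral_ofReal (hX.integrable n) (ae_of_all _ (hpos n))).symm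
      _ ≤ _ := ENNReal.ofReal_le_ofReal h1
  filter_upwards [hX.neg.exists_ae_tendsto_of_bdd hbdd] with ω ⟨x, hx⟩
  exact ⟨-x, by simpa using hx.neg⟩

/-- The maximal inequality for nonnegative supermartingales. -/
lemma mul_measureReal_exists_le (hX : Supermartingale X 𝓕 P) (hpos : ∀ n ω, 0 ≤ X n ω)
    (c : ℝ) : c * P.real {ω | ∃ n, c ≤ X n ω} ≤ ∫ ω, X 0 ω ∂P := by
  set A : ℕ → Set Ω := fun n => {ω | ∃ k ≤ n, c ≤ X k ω} with hA
  have hXm : ∀ n, MeasurableSet[𝓕 n] {ω | c ≤ X n ω} := fun n =>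
    (hX.stronglyMeasurable n).measurable measurableSet_Ici
  have hAm : ∀ n, MeasurableSet[𝓕 n] (A n) := by
    intro n
    have : A n = ⋃ k ∈ Set.Iic n, {ω | c ≤ X k ω} := by
      ext ω
      simp [hA]
    rw [this]
    exact MeasurableSet.biUnion (Set.to_countable _) fun k hk => 𝓕.mono hk _ (hXm k)
  have hAm' : ∀ n, MeasurableSet (A n) := fun n => 𝓕.le n _ (hAm n)
  have hstep : ∀ s : Set Ω, MeasurableSet s → ∀ n, (∀ ω ∈ s, c ≤ X n ω) →
      c * P.real s ≤ ∫ ω in s, X n ω ∂P := by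
    intro s hs n hsX
    have := setIntegral_mono_on (integrableOn_const (measure_ne_top P s))
      (hX.integrable n).integrableOn hs (f := fun _ => c) hsX
    rwa [setIntegral_const, smul_eq_mul, mul_comm] at this
  -- The mass stopped at level `c` up to time `n`, plus what is left, never exceeds the start.
  have key : ∀ n, c * P.real (A n) + ∫ ω in (A n)ᶜ, X n ω ∂P ≤ ∫ ω, X 0 ω ∂P := by
    intro n
    induction n with
    | zero =>
      have h1 := hstep (A 0) (hAm' 0) 0 (by simp [hA])
      have h2 := integral_add_compl (hAm' 0) (hX.integrable 0)
      linarith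
    | succ n ih =>
      set B : Set Ω := A (n + 1) \ A n with hB
      have hBX : ∀ ω ∈ B, c ≤ X (n + 1) ω := by
        rintro ω ⟨⟨k, hk, hkc⟩, hn⟩
        rcases Nat.lt_or_ge n k with h | h
        · rwa [show n + 1 = k by omega]
        · exact absurd ⟨k, h, hkc⟩ hn
      have hBm : MeasurableSet B := (hAm' (n + 1)).diff (hAm' n)
      have h1 := hstep B hBm (n + 1) hBX
      have hsub : A n ⊆ A (n + 1) := fun ω ⟨k, hk, hkc⟩ => ⟨k, by omega, hkc⟩
      have h2 : P.real (A (n + 1)) = P.real (A n) + P.real B := by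
        rw [hB, measureReal_sdiff hsub (hAm' n)]
        ring
      have h3 : ∫ ω in (A n)ᶜ, X (n + 1) ω ∂P =
          ∫ ω in B, X (n + 1) ω ∂P + ∫ ω in (A (n + 1))ᶜ, X (n + 1) ω ∂P := by
        rw [← setIntegral_union _ (hAm' (n + 1)).compl (hX.integrable _).integrableOn
          (hX.integrable _).integrableOn]
        · congr 2
          ext ω
          have := @hsub ω
          simp only [hB, Set.mem_compl_iff, Set.mem_union, Set.mem_sdiff]
          tauto
        · rw [Set.disjoint_left]
          rintro ω ⟨h, -⟩ h'
          exact h' h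
      have h4 := hX.setIntegral_le (Nat.le_succ n) (hAm n).compl
      rw [Nat.succ_eq_add_one] at h4
      rw [h2]
      linarith
  have hU : {ω | ∃ n, c ≤ X n ω} = ⋃ n, A n := by
    ext ω
    simp only [hA, Set.mem_ofPred_eq, Set.mem_iUnion]
    exact ⟨fun ⟨n, hn⟩ => ⟨n, n, le_rfl, hn⟩, fun ⟨_, k, _, hk⟩ => ⟨k, hk⟩⟩
  have hmono : Monotone A := fun a b hab ω ⟨k, hk, hkc⟩ => ⟨k, hk.trans hab, hkc⟩
  have hlim : Tendsto (fun n => c * P.real (A n)) atTop (𝓝 (c * P.real (⋃ n, A n))) :=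
    ((ENNReal.tendsto_toReal (measure_ne_top _ _)).comp
      (tendsto_measure_iUnion_atTop hmono)).const_mul c
  rw [hU]
  refine le_of_tendsto' hlim fun n => ?_
  have := setIntegral_nonneg (μ := P) (hAm' n).compl fun ω _ => hpos n ω
  linarith [key n]

end Supermartingale

/-! ### Functions of the degrees of two vertices as supermartingales -/

section Degree

variable {Ω : Type*}

/-- The degree of `v_i` after `k` edges, as a random variable. -/
noncomputable def deg (m T : ℕ → Ω → ℕ) (k i : ℕ) (ω : Ω) : ℕ :=
  degree (fun j => m j ω) (fun l => T l ω) k i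

lemma deg_le (m T : ℕ → Ω → ℕ) (k i : ℕ) (ω : Ω) : deg m T k i ω ≤ 2 * k :=
  degree_le _ _ _ _

lemma deg_mono (m T : ℕ → Ω → ℕ) (i : ℕ) (ω : Ω) : Monotone fun k => deg m T k i ω :=
  degree_mono _ _ _

lemma measurableSet_edgeTotal_le (m T : ℕ → Ω → ℕ) (l k i : ℕ) :
    MeasurableSet[history m T l] {ω | edgeTotal (fun j => m j ω) i ≤ k} :=
  measurable_history_edgeTotal m T l i (Set.to_countable (Set.Iic k)).measurableSet

variable [mΩ : MeasurableSpace Ω] {P : Measure Ω} {f : ℕ → ℝ} {m T : ℕ → Ω → ℕ}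

lemma measurable_deg (h : IsAttachmentModel P f m T) {l k : ℕ} (hl : l ≤ k) (i : ℕ) :
    Measurable[history m T k] (deg m T l i) :=
  measurable_history_degree h.one_le_attachment T hl i

lemma measurable_comp_deg (h : IsAttachmentModel P f m T) (k i j : ℕ) (φ : ℕ → ℕ → ℝ) :
    Measurable[history m T k] fun ω => φ (deg m T k i ω) (deg m T k j ω) :=
  (Measurable.of_discrete (f := fun p : ℕ × ℕ => φ p.1 p.2)).comp
    ((measurable_deg h le_rfl i).prodMk (measurable_deg h le_rfl j))

lemma deg_succ (h : IsAttachmentModel P f m T) {k i : ℕ} {ω : Ω}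
    (hi : edgeTotal (fun j => m j ω) i ≤ k) :
    deg m T (k + 1) i ω = deg m T k i ω + (if T (k + 1) ω = i then 1 else 0) :=
  degree_succ_of_edgeTotal_le (h.one_le ω) hi

end Degree

section Pair

variable {Ω : Type*} [mΩ : MeasurableSpace Ω] {P : Measure Ω} [IsProbabilityMeasure P]
  {f : ℕ → ℝ} {C : ℝ} {m T : ℕ → Ω → ℕ}

lemma exists_bound (g : ℕ → ℕ → ℝ) (N : ℕ) : ∃ c, ∀ x ≤ N, ∀ y ≤ N, |g x y| ≤ c := by
  refine ⟨∑ x ∈ Finset.range (N + 1), ∑ y ∈ Finset.range (N + 1), |g x y|, fun x hx y hy => ?_⟩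
  calc |g x y| ≤ ∑ y ∈ Finset.range (N + 1), |g x y| :=
        Finset.single_le_sum (f := fun y => |g x y|) (fun _ _ => abs_nonneg _)
          (Finset.mem_range.2 (by omega))
    _ ≤ _ := Finset.single_le_sum (f := fun x => ∑ y ∈ Finset.range (N + 1), |g x y|)
          (fun _ _ => Finset.sum_nonneg fun _ _ => abs_nonneg _) (Finset.mem_range.2 (by omega))

/-- The conditional expectation of a quantity that depends on the next target only through whether
it is `v_i` or `v_j`. -/
lemma condExp_step (h : IsAttachmentModel P f m T) (k i j : ℕ) {u v w : Ω → ℝ} {c : ℝ}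
    (hu : StronglyMeasurable[history m T k] u) (hv : StronglyMeasurable[history m T k] v)
    (hw : StronglyMeasurable[history m T k] w) (hub : ∀ ω, |u ω| ≤ c) (hvb : ∀ ω, |v ω| ≤ c)
    (hwb : ∀ ω, |w ω| ≤ c) :
    P[u + v * ({ω | T (k + 1) ω = i}.indicator fun _ => (1 : ℝ)) +
        w * ({ω | T (k + 1) ω = j}.indicator fun _ => (1 : ℝ)) | history m T k] =ᵐ[P]
      fun ω => u ω + v ω * attachProb f (fun j => m j ω) (fun l => T l ω) k i +
        w ω * attachProb f (fun j => m j ω) (fun l => T l ω) k j := by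
  have hle := h.history_le k
  have hI : ∀ i, Integrable ({ω | T (k + 1) ω = i}.indicator fun _ => (1 : ℝ)) P := fun i =>
    (integrable_const 1).indicator (h.measurable_target (k + 1) (by omega)
      (measurableSet_singleton i))
  have hprod : ∀ (v : Ω → ℝ) (i : ℕ), StronglyMeasurable[history m T k] v → (∀ ω, |v ω| ≤ c) →
      Integrable (v * ({ω | T (k + 1) ω = i}.indicator fun _ => (1 : ℝ))) P := fun v i hv hvb =>
    (hI i).bdd_mul (hv.mono hle).aestronglyMeasurable (ae_of_all _ hvb)
  have hui : Integrable u P := Integrable.of_bound (hu.mono hle).aestronglyMeasurable c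
    (ae_of_all _ hub)
  filter_upwards [condExp_add (hui.add (hprod v i hv hvb)) (hprod w j hw hwb) (history m T k),
    condExp_add hui (hprod v i hv hvb) (history m T k),
    condExp_stronglyMeasurable_mul_of_bound hle hv (hI i) c (ae_of_all _ hvb),
    condExp_stronglyMeasurable_mul_of_bound hle hw (hI j) c (ae_of_all _ hwb),
    h.condProb_target k i, h.condProb_target k j] with ω h1 h2 h3 h4 h5 h6
  rw [h1, Pi.add_apply, h2, Pi.add_apply, h3, h4, condExp_of_stronglyMeasurable hle hu hui,
    Pi.mul_apply, Pi.mul_apply, h5, h6]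

/-- A function `g k x y` of the number `k` of edges and of the degrees `x`, `y` of two vertices
gives a supermartingale as soon as its expected one-step change is nonpositive, whatever the total
weight `s ≤ 3C(k+1)`. The process is switched on at time `k₀`, on an event of the past on which
both vertices have brought their edges and `y` has reached `y₀`. -/
lemma supermartingale_pair (h : IsAttachmentModel P f m T) (hf_pos : ∀ i, 0 < f i) (hC : 0 < C)
    (hf_le : ∀ i : ℕ, f i ≤ C * ((i : ℝ) + 1)) {i j k₀ y₀ : ℕ} (hij : i ≠ j) {E : Set Ω}
    (hE : MeasurableSet[history m T k₀] E)
    (hEi : ∀ ω ∈ E, edgeTotal (fun j => m j ω) i ≤ k₀)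
    (hEj : ∀ ω ∈ E, edgeTotal (fun j => m j ω) j ≤ k₀)
    (hEy : ∀ ω ∈ E, y₀ ≤ deg m T k₀ j ω) (g : ℕ → ℕ → ℕ → ℝ)
    (hg : ∀ k x y : ℕ, y₀ ≤ y → ∀ s : ℝ, 0 < s → s ≤ 3 * C * (k + 1) →
      g (k + 1) x y + (g (k + 1) (x + 1) y - g (k + 1) x y) * (f x / s) +
        (g (k + 1) x (y + 1) - g (k + 1) x y) * (f y / s) ≤ g k x y) :
    Supermartingale
      (fun n => E.indicator fun ω => g (k₀ + n) (deg m T (k₀ + n) i ω) (deg m T (k₀ + n) j ω))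
      (h.filtration k₀) P := by
  have hEn : ∀ n, MeasurableSet[history m T (k₀ + n)] E := fun n =>
    history_mono m T (Nat.le_add_right k₀ n) _ hE
  have hmeas : ∀ (n : ℕ) (φ : ℕ → ℕ → ℝ), StronglyMeasurable[history m T (k₀ + n)]
      (E.indicator fun ω => φ (deg m T (k₀ + n) i ω) (deg m T (k₀ + n) j ω)) := by
    intro n φ
    exact StronglyMeasurable.indicator (measurable_comp_deg h _ i j φ).stronglyMeasurable (hEn n)
  have hbound : ∀ (n : ℕ) (φ : ℕ → ℕ → ℝ), ∃ c, ∀ ω,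
      |E.indicator (fun ω => φ (deg m T (k₀ + n) i ω) (deg m T (k₀ + n) j ω)) ω| ≤ c := by
    intro n φ
    obtain ⟨c, hc⟩ := exists_bound φ (2 * (k₀ + n))
    refine ⟨max c 0, fun ω => ?_⟩
    by_cases hω : ω ∈ E
    · rw [Set.indicator_of_mem hω]
      exact (hc _ (deg_le _ _ _ _ _) _ (deg_le _ _ _ _ _)).trans (le_max_left _ _)
    · simp [Set.indicator_of_notMem hω]
  refine supermartingale_nat (fun n => hmeas n _) (fun n => ?_) fun n => ?_
  · obtain ⟨c, hc⟩ := hbound n (g (k₀ + n))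
    exact Integrable.of_bound ((hmeas n _).mono (h.history_le _)).aestronglyMeasurable c
      (ae_of_all _ hc)
  · set k := k₀ + n with hk
    set u := fun x y => g (k + 1) x y
    set v := fun x y => g (k + 1) (x + 1) y - g (k + 1) x y
    set w := fun x y => g (k + 1) x (y + 1) - g (k + 1) x y
    obtain ⟨c₁, hc₁⟩ := hbound n u
    obtain ⟨c₂, hc₂⟩ := hbound n v
    obtain ⟨c₃, hc₃⟩ := hbound n w
    have hstep := condExp_step h k i j (c := max c₁ (max c₂ c₃)) (hmeas n u) (hmeas n v)
      (hmeas n w) (fun ω => (hc₁ ω).trans (le_max_left _ _))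
      (fun ω => (hc₂ ω).trans ((le_max_left _ _).trans (le_max_right _ _)))
      (fun ω => (hc₃ ω).trans ((le_max_right _ _).trans (le_max_right _ _)))
    have heq : (E.indicator fun ω =>
        g (k₀ + (n + 1)) (deg m T (k₀ + (n + 1)) i ω) (deg m T (k₀ + (n + 1)) j ω)) =
        E.indicator (fun ω => u (deg m T k i ω) (deg m T k j ω)) +
        E.indicator (fun ω => v (deg m T k i ω) (deg m T k j ω)) *
          ({ω | T (k + 1) ω = i}.indicator fun _ => (1 : ℝ)) +
        E.indicator (fun ω => w (deg m T k i ω) (deg m T k j ω)) *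
          ({ω | T (k + 1) ω = j}.indicator fun _ => (1 : ℝ)) := by
      funext ω
      by_cases hω : ω ∈ E
      · have hi := deg_succ h ((hEi ω hω).trans (Nat.le_add_right k₀ n))
        have hj := deg_succ h ((hEj ω hω).trans (Nat.le_add_right k₀ n))
        simp only [Pi.add_apply, Pi.mul_apply, Set.indicator_of_mem hω]
        rw [← add_assoc, hi, hj, ← hk]
        by_cases h1 : T (k + 1) ω = i
        · have h2 : T (k + 1) ω ≠ j := h1 ▸ hij
          simp [Set.indicator, h1, hij, u, v, w]
        · by_cases h2 : T (k + 1) ω = j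
          · simp [Set.indicator, h2, hij.symm, u, v, w]
          · simp [Set.indicator, h1, h2, u, v, w]
      · simp [Set.indicator_of_notMem hω]
    rw [heq]
    change P[_ | history m T k] ≤ᵐ[P] _
    filter_upwards [hstep] with ω hω
    rw [hω]
    by_cases hωE : ω ∈ E
    · simp only [Set.indicator_of_mem hωE]
      have hm := h.one_le ω
      have hprob : ∀ i, edgeTotal (fun j => m j ω) i ≤ k₀ →
          attachProb f (fun j => m j ω) (fun l => T l ω) k i =
            f (deg m T k i ω) / totalWeight f (fun j => m j ω) (fun l => T l ω) k := by
        intro i hi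
        rw [attachProb, if_pos ((lt_source_succ_iff hm).2 (hi.trans (Nat.le_add_right k₀ n)))]
        rfl
      rw [hprob i (hEi ω hωE), hprob j (hEj ω hωE)]
      exact hg k _ _ ((hEy ω hωE).trans (deg_mono m T j ω (Nat.le_add_right k₀ n))) _
        (totalWeight_pos hf_pos hm k) (totalWeight_le hC hf_le hm k)
    · simp [Set.indicator_of_notMem hωE]

end Pair

/-! ### Logarithmic growth of the degrees -/

section Growth

lemma Phi_mono {f : ℕ → ℝ} (hf_pos : ∀ i, 0 < f i) (k : ℕ) : Monotone (Phi f k) :=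
  monotone_nat_of_le_succ fun n => by
    rw [Phi, Phi, Finset.sum_range_succ]
    have := hf_pos n
    have : 0 ≤ 1 / f n ^ k := by positivity
    linarith

lemma log_add_one_le_sum (n : ℕ) :
    Real.log ((n : ℝ) + 1) ≤ ∑ l ∈ Finset.range n, ((l : ℝ) + 1)⁻¹ := by
  have := log_add_one_le_harmonic n
  simpa [harmonic] using this

/-- The decreasing function `∏_{l<x} (1 + f(0)/f(l))⁻¹` of the degree. -/
noncomputable def decay (f : ℕ → ℝ) (x : ℕ) : ℝ :=
  ∏ l ∈ Finset.range x, (1 + f 0 / f l)⁻¹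

/-- The factor that compensates for the decrease of `decay` up to time `k`. -/
noncomputable def compensator (f : ℕ → ℝ) (C : ℝ) (k : ℕ) : ℝ :=
  ∏ l ∈ Finset.range k, (1 - f 0 / (6 * C * (l + 1)))⁻¹

variable {f : ℕ → ℝ} {C : ℝ}

lemma decay_pos (hf_pos : ∀ i, 0 < f i) (x : ℕ) : 0 < decay f x :=
  Finset.prod_pos fun l _ => by
    have := hf_pos 0
    have := hf_pos l
    positivity

lemma exp_le_decay (hf_pos : ∀ i, 0 < f i) (x : ℕ) :
    Real.exp (-(f 0 * Phi f 1 x)) ≤ decay f x := by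
  rw [Phi, Finset.mul_sum, ← Finset.sum_neg_distrib, Real.exp_sum]
  refine Finset.prod_le_prod (fun _ _ => (Real.exp_pos _).le) fun l _ => ?_
  have h0 := hf_pos 0
  have hl := hf_pos l
  rw [pow_one, mul_one_div, Real.exp_neg]
  refine inv_anti₀ (by positivity) ?_
  rw [add_comm]
  exact Real.add_one_le_exp _

lemma compensator_factor (hC : 0 < C)
    (hf_le : ∀ i : ℕ, f i ≤ C * ((i : ℝ) + 1)) (l : ℕ) :
    0 < 1 - f 0 / (6 * C * (l + 1)) := by
  have h0 : f 0 ≤ C := by simpa using hf_le 0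
  have hl : (0 : ℝ) ≤ l := by positivity
  rw [sub_pos, div_lt_one (by positivity)]
  nlinarith [mul_nonneg hC.le hl]

lemma compensator_pos (hC : 0 < C)
    (hf_le : ∀ i : ℕ, f i ≤ C * ((i : ℝ) + 1)) (k : ℕ) : 0 < compensator f C k :=
  Finset.prod_pos fun l _ => inv_pos.2 (compensator_factor hC hf_le l)

lemma exp_le_compensator (hf_pos : ∀ i, 0 < f i) (hC : 0 < C)
    (hf_le : ∀ i : ℕ, f i ≤ C * ((i : ℝ) + 1)) (k : ℕ) :
    Real.exp (f 0 / (6 * C) * Real.log ((k : ℝ) + 1)) ≤ compensator f C k := by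
  have h0 := hf_pos 0
  calc Real.exp (f 0 / (6 * C) * Real.log ((k : ℝ) + 1))
      ≤ Real.exp (f 0 / (6 * C) * ∑ l ∈ Finset.range k, ((l : ℝ) + 1)⁻¹) := by
        gcongr
        exact log_add_one_le_sum k
    _ = ∏ l ∈ Finset.range k, Real.exp (f 0 / (6 * C * (l + 1))) := by
        rw [Finset.mul_sum, Real.exp_sum]
        refine Finset.prod_congr rfl fun l _ => ?_
        congr 1
        field_simp
    _ ≤ compensator f C k := by
        refine Finset.prod_le_prod (fun _ _ => (Real.exp_pos _).le) fun l _ => ?_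
        have h1 := compensator_factor hC hf_le l
        rw [le_inv_comm₀ (Real.exp_pos _) h1, ← Real.exp_neg]
        have := Real.add_one_le_exp (-(f 0 / (6 * C * ((l : ℝ) + 1))))
        linarith

lemma decay_mul_compensator_drift (hf_pos : ∀ i, 0 < f i) (hf_mono : Monotone f) (hC : 0 < C)
    (hf_le : ∀ i : ℕ, f i ≤ C * ((i : ℝ) + 1)) (k x : ℕ) {s : ℝ} (hs : 0 < s)
    (hsk : s ≤ 3 * C * (k + 1)) :
    decay f x * compensator f C (k + 1) +
      (decay f (x + 1) * compensator f C (k + 1) - decay f x * compensator f C (k + 1)) *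
        (f x / s) ≤ decay f x * compensator f C k := by
  have h0 := hf_pos 0
  have hx := hf_pos x
  have hD := decay_pos hf_pos x
  have hB := compensator_pos hC hf_le k
  have hq := compensator_factor hC hf_le k
  have hD1 : decay f (x + 1) = decay f x * (1 + f 0 / f x)⁻¹ := by
    rw [decay, Finset.prod_range_succ, decay]
  have hB1 : compensator f C (k + 1) =
      compensator f C k * (1 - f 0 / (6 * C * (k + 1)))⁻¹ := by
    rw [compensator, Finset.prod_range_succ, compensator]
  -- As `f 0 ≤ f x`, a factor `1/2` is lost against the first-order change `f 0 / s`.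
  have key : f 0 / (6 * C * (k + 1)) ≤ (1 - (1 + f 0 / f x)⁻¹) * (f x / s) := by
    have h1 : (1 - (1 + f 0 / f x)⁻¹) * (f x / s) = f 0 / s * (f x / (f x + f 0)) := by
      field_simp
      ring
    have h2 : (1 : ℝ) / 2 ≤ f x / (f x + f 0) := by
      rw [div_le_div_iff₀ (by norm_num) (by positivity)]
      linarith [hf_mono (Nat.zero_le x)]
    have h3 : f 0 / (3 * C * (k + 1)) ≤ f 0 / s := by gcongr
    calc f 0 / (6 * C * (k + 1)) = f 0 / (3 * C * (k + 1)) * (1 / 2) := by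
          field_simp
          norm_num
      _ ≤ f 0 / s * (f x / (f x + f 0)) := by gcongr
      _ = _ := h1.symm
  rw [hD1, hB1]
  set q := f 0 / (6 * C * ((k : ℝ) + 1))
  have h4 : decay f x * (compensator f C k * (1 - q)⁻¹) +
      (decay f x * (1 + f 0 / f x)⁻¹ * (compensator f C k * (1 - q)⁻¹) -
        decay f x * (compensator f C k * (1 - q)⁻¹)) * (f x / s) =
      decay f x * compensator f C k * (1 - q)⁻¹ *
        (1 - (1 - (1 + f 0 / f x)⁻¹) * (f x / s)) := by ring
  rw [h4]
  calc decay f x * compensator f C k * (1 - q)⁻¹ * (1 - (1 - (1 + f 0 / f x)⁻¹) * (f x / s))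
      ≤ decay f x * compensator f C k * (1 - q)⁻¹ * (1 - q) := by gcongr
    _ = _ := by field_simp

variable {Ω : Type*} [mΩ : MeasurableSpace Ω] {P : Measure Ω} [IsProbabilityMeasure P]
  {m T : ℕ → Ω → ℕ}

/-- The degree of every vertex is at least logarithmic on the scale of `Φ₁`: half of the first-order
growth rate `1/(3C)`, which the bound `3C(k+1)` on the total weight would give, is enough. -/
lemma ae_log_le_Phi_deg (h : IsAttachmentModel P f m T) (hf_pos : ∀ i, 0 < f i)
    (hf_mono : Monotone f) (hC : 0 < C) (hf_le : ∀ i : ℕ, f i ≤ C * ((i : ℝ) + 1)) (i : ℕ) :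
    ∀ᵐ ω ∂P, ∃ (R : ℝ) (k₀ : ℕ), ∀ k ≥ k₀,
      Real.log ((k : ℝ) + 1) / (6 * C) - R ≤ Phi f 1 (deg m T k i ω) := by
  have h0 := hf_pos 0
  set g : ℕ → ℕ → ℕ → ℝ := fun k x _ => decay f x * compensator f C k with hg
  have hgpos : ∀ k x y, 0 < g k x y := fun k x _ =>
    mul_pos (decay_pos hf_pos x) (compensator_pos hC hf_le k)
  have key : ∀ k₀ : ℕ, ∀ᵐ ω ∂P, ∃ z, Tendsto (fun n =>
      {ω | edgeTotal (fun j => m j ω) (i + 1) ≤ k₀}.indicator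
        (fun ω => g (k₀ + n) (deg m T (k₀ + n) i ω) (deg m T (k₀ + n) (i + 1) ω)) ω)
      atTop (𝓝 z) := by
    intro k₀
    refine ae_exists_tendsto_of_supermartingale
      (supermartingale_pair h hf_pos hC hf_le (y₀ := 0) (Nat.succ_ne_self i).symm
        (measurableSet_edgeTotal_le m T k₀ k₀ (i + 1)) (fun ω hω => ?_) (fun ω hω => hω)
        (fun ω _ => Nat.zero_le _) g fun k x y _ s hs hsk => ?_) fun n ω => ?_
    · exact ((edgeTotal_strictMono (h.one_le ω)).monotone (Nat.le_succ i)).trans hω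
    · have := decay_mul_compensator_drift hf_pos hf_mono hC hf_le k x hs hsk
      simpa [hg] using this
    · exact Set.indicator_nonneg (fun ω _ => (hgpos _ _ 0).le) ω
  filter_upwards [ae_all_iff.2 key] with ω hω
  set k₀ := edgeTotal (fun j => m j ω) (i + 1) with hk₀
  obtain ⟨z, hz⟩ := hω k₀
  obtain ⟨M, hM⟩ := hz.bddAbove_range
  refine ⟨Real.log (max M 1) / f 0, k₀, fun k hk => ?_⟩
  obtain ⟨n, rfl⟩ := Nat.exists_eq_add_of_le hk
  have h1 : g (k₀ + n) (deg m T (k₀ + n) i ω) 0 ≤ max M 1 := by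
    refine le_trans ?_ (le_max_left _ _)
    have := hM (Set.mem_range_self n)
    rwa [Set.indicator_of_mem (show ω ∈ {ω | edgeTotal (fun j => m j ω) (i + 1) ≤ k₀} from hk₀.ge)]
      at this
  have h2 : Real.exp (-(f 0 * Phi f 1 (deg m T (k₀ + n) i ω)) +
      f 0 / (6 * C) * Real.log (((k₀ + n : ℕ) : ℝ) + 1)) ≤ max M 1 := by
    rw [Real.exp_add]
    refine le_trans ?_ h1
    exact mul_le_mul (exp_le_decay hf_pos _) (exp_le_compensator hf_pos hC hf_le _)
      (Real.exp_pos _).le (decay_pos hf_pos _).le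
  rw [← Real.le_log_iff_exp_le (by positivity)] at h2
  rw [sub_le_iff_le_add, ← mul_le_mul_iff_right₀ h0]
  calc f 0 * (Real.log (((k₀ + n : ℕ) : ℝ) + 1) / (6 * C))
      = f 0 / (6 * C) * Real.log (((k₀ + n : ℕ) : ℝ) + 1) := by ring
    _ ≤ f 0 * Phi f 1 (deg m T (k₀ + n) i ω) + Real.log (max M 1) := by linarith
    _ = _ := by field_simp

lemma ae_tendsto_deg (h : IsAttachmentModel P f m T) (hf_pos : ∀ i, 0 < f i)
    (hf_mono : Monotone f) (hC : 0 < C) (hf_le : ∀ i : ℕ, f i ≤ C * ((i : ℝ) + 1)) (i : ℕ) :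
    ∀ᵐ ω ∂P, Tendsto (fun k => deg m T k i ω) atTop atTop := by
  filter_upwards [ae_log_le_Phi_deg h hf_pos hf_mono hC hf_le i] with ω ⟨R, k₀, hR⟩
  have hlog : Tendsto (fun k : ℕ => Real.log ((k : ℝ) + 1) / (6 * C) - R) atTop atTop := by
    refine tendsto_atTop_add_const_right _ _ (Tendsto.atTop_div_const (by positivity) ?_)
    exact Real.tendsto_log_atTop.comp
      (tendsto_atTop_add_const_right _ _ tendsto_natCast_atTop_atTop)
  refine tendsto_atTop.2 fun b => ?_
  filter_upwards [hlog.eventually_gt_atTop (Phi f 1 b), eventually_ge_atTop k₀] with k hk hk₀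
  by_contra hcon
  have := Phi_mono hf_pos 1 (not_le.1 hcon).le
  linarith [hR k hk₀]

end Growth

/-! ### Late vertices never catch up -/

section Late

variable {f : ℕ → ℝ} {C : ℝ}

lemma summable_one_div_sq (hf_pos : ∀ i, 0 < f i)
    (hPhi2 : ∃ L : ℝ, Tendsto (Phi f 2) atTop (𝓝 L)) : Summable fun l => 1 / f l ^ 2 := by
  obtain ⟨L, hL⟩ := hPhi2
  exact ((hasSum_iff_tendsto_nat_of_nonneg
    (fun i => by have := hf_pos i; positivity) L).2 hL).summable

/-- The exponential-type weight `∏_{l<x} (1 + r/f(l))` of the degree of the pursuing vertex. -/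
noncomputable def riseWeight (f : ℕ → ℝ) (r : ℝ) (x : ℕ) : ℝ :=
  ∏ l ∈ Finset.range x, (1 + r / f l)

/-- The weight `∏_{y₀≤l<y} (1 - r/f(l))` of the degree of the leading vertex. -/
noncomputable def fallWeight (f : ℕ → ℝ) (r : ℝ) (y₀ y : ℕ) : ℝ :=
  ∏ l ∈ Finset.Ico y₀ y, (1 - r / f l)

lemma riseWeight_pos (hf_pos : ∀ i, 0 < f i) {r : ℝ} (hr : 0 < r) (x : ℕ) :
    0 < riseWeight f r x :=
  Finset.prod_pos fun l _ => by
    have := hf_pos l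
    positivity

lemma riseWeight_mono (hf_pos : ∀ i, 0 < f i) {r : ℝ} (hr : 0 < r) :
    Monotone (riseWeight f r) :=
  monotone_nat_of_le_succ fun x => by
    have h1 := riseWeight_pos hf_pos hr x
    have h2 := hf_pos x
    have h3 : riseWeight f r (x + 1) = riseWeight f r x * (1 + r / f x) :=
      Finset.prod_range_succ _ _
    rw [h3]
    exact le_mul_of_one_le_right h1.le (by simp only [le_add_iff_nonneg_right]; positivity)

lemma riseWeight_le_exp (hf_pos : ∀ i, 0 < f i) {r : ℝ} (hr : 0 < r) (x : ℕ) :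
    riseWeight f r x ≤ Real.exp (r * Phi f 1 x) := by
  rw [Phi, Finset.mul_sum, Real.exp_sum]
  refine Finset.prod_le_prod (fun l _ => ?_) fun l _ => ?_
  · have := hf_pos l
    positivity
  · rw [pow_one, mul_one_div, add_comm]
    exact Real.add_one_le_exp _

lemma fall_factor_pos (hf_pos : ∀ i, 0 < f i) {r : ℝ} {l : ℕ} (hl : 2 * r < f l) :
    0 < 1 - r / f l := by
  have := hf_pos l
  rw [sub_pos, div_lt_one this]
  linarith

lemma fallWeight_pos (hf_pos : ∀ i, 0 < f i) {r : ℝ} {y₀ : ℕ} (hy₀ : ∀ l ≥ y₀, 2 * r < f l)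
    (y : ℕ) : 0 < fallWeight f r y₀ y :=
  Finset.prod_pos fun l hl => fall_factor_pos hf_pos (hy₀ l (Finset.mem_Ico.1 hl).1)

lemma fallWeight_le_exp (hf_pos : ∀ i, 0 < f i) {r : ℝ} {y₀ : ℕ}
    (hy₀ : ∀ l ≥ y₀, 2 * r < f l) {y : ℕ} (hy : y₀ ≤ y) :
    fallWeight f r y₀ y ≤ Real.exp (-(r * (Phi f 1 y - Phi f 1 y₀))) := by
  rw [Phi, Phi, ← Finset.sum_Ico_eq_sub _ hy, Finset.mul_sum, ← Finset.sum_neg_distrib,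
    Real.exp_sum]
  refine Finset.prod_le_prod (fun l hl => ?_) fun l _ => ?_
  · exact (fall_factor_pos hf_pos (hy₀ l (Finset.mem_Ico.1 hl).1)).le
  · rw [pow_one, mul_one_div]
    have := Real.add_one_le_exp (-(r / f l))
    linarith

lemma riseWeight_mul_fallWeight_drift (hf_pos : ∀ i, 0 < f i) (r : ℝ) {y₀ y : ℕ} (hy : y₀ ≤ y)
    (x : ℕ) {s : ℝ} (hs : 0 < s) :
    riseWeight f r x * fallWeight f r y₀ y +
      (riseWeight f r (x + 1) * fallWeight f r y₀ y - riseWeight f r x * fallWeight f r y₀ y) *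
        (f x / s) +
      (riseWeight f r x * fallWeight f r y₀ (y + 1) - riseWeight f r x * fallWeight f r y₀ y) *
        (f y / s) = riseWeight f r x * fallWeight f r y₀ y := by
  have hx := hf_pos x
  have hy' := hf_pos y
  have h1 : riseWeight f r (x + 1) = riseWeight f r x * (1 + r / f x) := Finset.prod_range_succ _ _
  have h2 : fallWeight f r y₀ (y + 1) = fallWeight f r y₀ y * (1 - r / f y) :=
    Finset.prod_Ico_succ_top hy _
  rw [h1, h2]
  field_simp
  ring

/-- When the pursuer has caught up, the product of the weights exceeds a constant: there the two
first-order terms cancel, and the second-order ones are summable. -/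
lemma exp_le_riseWeight_mul_fallWeight (hf_pos : ∀ i, 0 < f i)
    (hsum : Summable fun l => 1 / f l ^ 2) {r : ℝ} (hr : 0 < r) {y₀ : ℕ}
    (hy₀ : ∀ l ≥ y₀, 2 * r < f l) {x y : ℕ} (hxy : y ≤ x) :
    Real.exp (-(2 * r ^ 2 * ∑' l, 1 / f l ^ 2)) ≤ riseWeight f r x * fallWeight f r y₀ y := by
  have hnn : ∀ l, 0 ≤ 1 / f l ^ 2 := fun l => by have := hf_pos l; positivity
  have h1 : ∏ l ∈ Finset.Ico y₀ y, (1 + r / f l) ≤ riseWeight f r y := by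
    refine Finset.prod_le_prod_of_subset_of_one_le (fun l hl => ?_) (fun l _ => ?_) fun l _ _ => ?_
    · exact Finset.mem_range.2 (Finset.mem_Ico.1 hl).2
    · have := hf_pos l
      positivity
    · have := hf_pos l
      rw [le_add_iff_nonneg_right]
      positivity
  calc Real.exp (-(2 * r ^ 2 * ∑' l, 1 / f l ^ 2))
      ≤ Real.exp (∑ l ∈ Finset.Ico y₀ y, -(2 * r ^ 2 * (1 / f l ^ 2))) := by
        rw [Finset.sum_neg_distrib, ← Finset.mul_sum]
        gcongr
        exact hsum.sum_le_tsum _ fun l _ => hnn l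
    _ ≤ ∏ l ∈ Finset.Ico y₀ y, (1 + r / f l) * (1 - r / f l) := by
        rw [Real.exp_sum]
        refine Finset.prod_le_prod (fun _ _ => (Real.exp_pos _).le) fun l hl => ?_
        have hl2 := hy₀ l (Finset.mem_Ico.1 hl).1
        have hfl := hf_pos l
        have hu : (1 + r / f l) * (1 - r / f l) = 1 - r ^ 2 * (1 / f l ^ 2) := by
          field_simp
          ring
        have hu1 : r ^ 2 * (1 / f l ^ 2) ≤ 1 / 2 := by
          rw [mul_one_div, div_le_iff₀ (by positivity)]
          nlinarith
        have hu0 : 0 ≤ r ^ 2 * (1 / f l ^ 2) := by positivity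
        rw [hu, mul_assoc 2]
        set v := r ^ 2 * (1 / f l ^ 2)
        have h3 : Real.exp (-(2 * v)) ≤ (1 + 2 * v)⁻¹ := by
          rw [Real.exp_neg]
          refine inv_anti₀ (by positivity) ?_
          linarith [Real.add_one_le_exp (2 * v)]
        refine h3.trans ?_
        rw [inv_le_iff_one_le_mul₀ (by positivity)]
        nlinarith
    _ = (∏ l ∈ Finset.Ico y₀ y, (1 + r / f l)) * fallWeight f r y₀ y := Finset.prod_mul_distrib
    _ ≤ riseWeight f r x * fallWeight f r y₀ y := by
        gcongr
        · exact (fallWeight_pos hf_pos hy₀ y).le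
        · exact h1.trans (riseWeight_mono hf_pos hr hxy)

lemma exists_lt_of_summable (hf_pos : ∀ i, 0 < f i) (hsum : Summable fun l => 1 / f l ^ 2)
    {r : ℝ} (hr : 0 < r) : ∃ y₀, ∀ l ≥ y₀, r < f l := by
  have h := hsum.tendsto_atTop_zero.eventually_lt_const (show 0 < 1 / r ^ 2 by positivity)
  obtain ⟨y₀, hy₀⟩ := eventually_atTop.1 h
  refine ⟨y₀, fun l hl => ?_⟩
  have h1 := hf_pos l
  have h2 := (one_div_lt_one_div (by positivity) (by positivity)).1 (hy₀ l hl)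
  exact lt_of_pow_lt_pow_left₀ 2 h1.le h2

variable {Ω : Type*} [mΩ : MeasurableSpace Ω] {P : Measure Ω} {m T : ℕ → Ω → ℕ}

/-- The event that `v_n` is born at time `k`, when `v_i` has brought its edges and has a degree of
at least `y₀`, and that the product of their weights is then at most `b`. -/
def lateEvent (f : ℕ → ℝ) (m T : ℕ → Ω → ℕ) (r b : ℝ) (y₀ i n k : ℕ) : Set Ω :=
  {ω | edgeTotal (fun j => m j ω) n = k} ∩ {ω | edgeTotal (fun j => m j ω) i ≤ k} ∩
    {ω | y₀ ≤ deg m T k i ω} ∩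
    {ω | riseWeight f r (deg m T k n ω) * fallWeight f r y₀ (deg m T k i ω) ≤ b}

lemma measurableSet_lateEvent (h : IsAttachmentModel P f m T) (r b : ℝ) (y₀ i n k : ℕ) :
    MeasurableSet[history m T k] (lateEvent f m T r b y₀ i n k) := by
  have hw : Measurable[history m T k] fun ω =>
      riseWeight f r (deg m T k n ω) * fallWeight f r y₀ (deg m T k i ω) :=
    measurable_comp_deg h k n i fun x y => riseWeight f r x * fallWeight f r y₀ y
  refine MeasurableSet.inter (MeasurableSet.inter (MeasurableSet.inter ?_ ?_) ?_) ?_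
  · exact measurable_history_edgeTotal m T k n (measurableSet_singleton k)
  · exact measurableSet_edgeTotal_le m T k k i
  · exact measurable_deg h le_rfl i (Set.to_countable (Set.Ici y₀)).measurableSet
  · exact hw (measurableSet_Iic (a := b))

variable [IsProbabilityMeasure P]

/-- A late vertex with small initial weight catches up with small probability. -/
lemma measureReal_catch_up_le (h : IsAttachmentModel P f m T) (hf_pos : ∀ i, 0 < f i) (hC : 0 < C)
    (hf_le : ∀ i : ℕ, f i ≤ C * ((i : ℝ) + 1)) (hsum : Summable fun l => 1 / f l ^ 2)
    {r : ℝ} (hr : 0 < r) {y₀ : ℕ} (hy₀ : ∀ l ≥ y₀, 2 * r < f l) {i n : ℕ} (hin : n ≠ i) (k : ℕ)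
    {b : ℝ} (hb : 0 ≤ b) :
    P.real {ω | ω ∈ lateEvent f m T r b y₀ i n k ∧
        ∃ l, deg m T (k + l) i ω ≤ deg m T (k + l) n ω} ≤
      b * Real.exp (2 * r ^ 2 * ∑' l, 1 / f l ^ 2) := by
  set E := lateEvent f m T r b y₀ i n k
  have hE : MeasurableSet[history m T k] E := measurableSet_lateEvent h r b y₀ i n k
  set g : ℕ → ℕ → ℕ → ℝ := fun _ x y => riseWeight f r x * fallWeight f r y₀ y with hg
  have hgpos : ∀ k x y, 0 < g k x y := fun _ x y =>
    mul_pos (riseWeight_pos hf_pos hr x) (fallWeight_pos hf_pos hy₀ y)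
  have hX := supermartingale_pair h hf_pos hC hf_le (y₀ := y₀) hin hE
    (fun ω hω => hω.1.1.1.le) (fun ω hω => hω.1.1.2) (fun ω hω => hω.1.2) g
    fun k x y hy s hs _ => (riseWeight_mul_fallWeight_drift hf_pos r hy x hs).le
  have hmax := mul_measureReal_exists_le hX
    (fun l ω => Set.indicator_nonneg (fun ω _ => (hgpos (k + l) _ _).le) ω)
    (Real.exp (-(2 * r ^ 2 * ∑' l, 1 / f l ^ 2)))
  have h0 : ∫ ω, E.indicator (fun ω => g (k + 0) (deg m T (k + 0) n ω) (deg m T (k + 0) i ω)) ω ∂P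
      ≤ b := by
    calc _ ≤ ∫ _, b ∂P := by
          refine integral_mono (hX.integrable 0) (integrable_const b) fun ω => ?_
          by_cases hω : ω ∈ E
          · simp only [Set.indicator_of_mem hω]
            exact hω.2
          · simp only [Set.indicator_of_notMem hω]
            exact hb
      _ = b := by simp
  have hsub : {ω | ω ∈ E ∧ ∃ l, deg m T (k + l) i ω ≤ deg m T (k + l) n ω} ⊆
      {ω | ∃ l, Real.exp (-(2 * r ^ 2 * ∑' l, 1 / f l ^ 2)) ≤
        E.indicator (fun ω => g (k + l) (deg m T (k + l) n ω) (deg m T (k + l) i ω)) ω} := by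
    rintro ω ⟨hω, l, hl⟩
    refine ⟨l, ?_⟩
    rw [Set.indicator_of_mem hω]
    exact exp_le_riseWeight_mul_fallWeight hf_pos hsum hr hy₀ hl
  have h1 := (hmax.trans h0)
  refine (measureReal_mono hsub).trans ?_
  rwa [Real.exp_neg, inv_mul_le_iff₀ (Real.exp_pos _), ← Real.exp_neg, mul_comm (Real.exp _)] at h1

/-- For almost every realization, all but finitely many vertices stay below a given vertex `v_i`
from their birth on. -/
lemma ae_eventually_deg_lt (h : IsAttachmentModel P f m T) (hf_pos : ∀ i, 0 < f i)
    (hf_mono : Monotone f) (hC : 0 < C) (hf_le : ∀ i : ℕ, f i ≤ C * ((i : ℝ) + 1))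
    (hsum : Summable fun l => 1 / f l ^ 2)
    (hedge : ∀ᵐ ω ∂P,
      limsup (fun n : ℕ =>
        ((Phi f 1 (m n ω) / Real.log (edgeTotal (fun j => m j ω) n : ℝ) : ℝ) : EReal)) atTop
        ≤ ((1 / (8 * C) : ℝ) : EReal)) (i : ℕ) :
    ∀ᵐ ω ∂P, ∀ᶠ n in atTop, ∀ k ≥ edgeTotal (fun j => m j ω) n,
      deg m T k n ω < deg m T k i ω := by
  -- A newborn vertex starts at `Φ₁ ≤ log(s_n)/(7C)`, whereas `v_i` is at `log(s_n)/(6C)` or more: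
  -- this exponent turns the gap `log(s_n)/(42C)` into the factor `s_n⁻³`.
  set r : ℝ := 126 * C with hr_def
  have hr : 0 < r := by positivity
  obtain ⟨y₀, hy₀⟩ := exists_lt_of_summable hf_pos hsum (show 0 < 2 * r by positivity)
  set c : ℝ := Real.exp (2 * r ^ 2 * ∑' l, 1 / f l ^ 2) with hc
  set bad : ℕ → ℕ → Set Ω := fun R k => ⋃ n ∈ (Finset.range (k + 1)).filter (· ≠ i),
    {ω | ω ∈ lateEvent f m T r (R / ((k : ℝ) + 1) ^ 3) y₀ i n k ∧
        ∃ l, deg m T (k + l) i ω ≤ deg m T (k + l) n ω} with hbad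
  have hbadP : ∀ R k : ℕ, P.real (bad R k) ≤ R * c * (1 / ((k : ℝ) + 1) ^ 2) := by
    intro R k
    calc P.real (bad R k)
        ≤ ∑ n ∈ (Finset.range (k + 1)).filter (· ≠ i), R / ((k : ℝ) + 1) ^ 3 * c :=
          (measureReal_biUnion_finset_le _ _).trans (Finset.sum_le_sum fun n hn =>
            measureReal_catch_up_le h hf_pos hC hf_le hsum hr hy₀ (Finset.mem_filter.1 hn).2 k
              (by positivity))
      _ ≤ ∑ n ∈ Finset.range (k + 1), R / ((k : ℝ) + 1) ^ 3 * c :=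
          Finset.sum_le_sum_of_subset_of_nonneg (Finset.filter_subset _ _)
            fun _ _ _ => by positivity
      _ = R * c * (1 / ((k : ℝ) + 1) ^ 2) := by
          rw [Finset.sum_const, Finset.card_range, nsmul_eq_mul]
          push_cast
          field_simp
  have hBC : ∀ R : ℕ, ∀ᵐ ω ∂P, ∀ᶠ k in atTop, ω ∉ bad R k := by
    intro R
    refine ae_eventually_notMem ?_
    have hs : Summable fun k : ℕ => R * c * (1 / ((k : ℝ) + 1) ^ 2) := by
      refine Summable.mul_left _ ?_
      have := (summable_nat_add_iff 1).2 (Real.summable_one_div_nat_pow.2 (le_refl 2))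
      simpa using this
    refine ne_top_of_le_ne_top hs.tsum_ofReal_ne_top (ENNReal.tsum_le_tsum fun k => ?_)
    rw [← ofReal_measureReal (measure_ne_top P _)]
    exact ENNReal.ofReal_le_ofReal (hbadP R k)
  filter_upwards [ae_all_iff.2 hBC, hedge, ae_log_le_Phi_deg h hf_pos hf_mono hC hf_le i,
    ae_tendsto_deg h hf_pos hf_mono hC hf_le i, h.ae_target_lt_source] with
    ω hω hωedge ⟨R₀, k₀, hR₀⟩ hωdeg hωT
  set s := edgeTotal (fun j => m j ω) with hs
  have hsn : ∀ n, n ≤ s n := le_edgeTotal (h.one_le ω)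
  have hsT : Tendsto s atTop atTop := tendsto_atTop_mono hsn tendsto_id
  have hlim : ∀ᶠ n in atTop, Phi f 1 (m n ω) / Real.log (s n) < 1 / (7 * C) := by
    have h1 : ((1 / (8 * C) : ℝ) : EReal) < ((1 / (7 * C) : ℝ) : EReal) := by
      rw [EReal.coe_lt_coe_iff]
      exact one_div_lt_one_div_of_lt (by positivity) (by linarith)
    filter_upwards [eventually_lt_of_limsup_lt (hωedge.trans_lt h1)] with n hn
    exact EReal.coe_lt_coe_iff.1 hn
  obtain ⟨R, hR⟩ := exists_nat_ge (Real.exp (r * (R₀ + Phi f 1 y₀)))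
  filter_upwards [hlim, eventually_ge_atTop 2, eventually_gt_atTop i,
    hsT.eventually (hω R), hsT.eventually (eventually_ge_atTop k₀),
    (hωdeg.comp hsT).eventually (eventually_ge_atTop y₀)] with n h1 h2 h3 h4 h5 h6 k hk
  by_contra hcon
  obtain ⟨l, rfl⟩ := Nat.exists_eq_add_of_le hk
  refine h4 (Set.mem_biUnion (x := n) ?_ ⟨⟨⟨⟨rfl, ?_⟩, h6⟩, ?_⟩, l, not_lt.1 hcon⟩)
  · simp only [Finset.coe_filter, Finset.mem_range, Set.mem_ofPred_eq]
    exact ⟨Nat.lt_succ_of_le (hsn n), h3.ne'⟩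
  · exact (edgeTotal_strictMono (h.one_le ω)).monotone h3.le
  · have hs2 : (2 : ℝ) ≤ s n := by exact_mod_cast h2.trans (hsn n)
    have hlog : 0 < Real.log (s n) := Real.log_pos (by linarith)
    have hdn : deg m T (s n) n ω = m n ω :=
      degree_edgeTotal_self (h.one_le ω) hωT (by omega)
    rw [div_lt_div_iff₀ hlog (by positivity), one_mul] at h1
    have h7 : Real.log (s n) ≤ Real.log ((s n : ℝ) + 1) :=
      Real.log_le_log (by linarith) (by linarith)
    have h8 := hR₀ (s n) h5
    have h9 : Phi f 1 (m n ω) ≤ Real.log ((s n : ℝ) + 1) / (7 * C) := by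
      rw [le_div_iff₀ (by positivity)]
      linarith
    have hexp : Real.exp (-(3 * Real.log ((s n : ℝ) + 1))) = 1 / ((s n : ℝ) + 1) ^ 3 := by
      rw [Real.exp_neg, mul_comm, Real.exp_mul, Real.exp_log (by positivity), one_div]
      norm_cast
    change riseWeight f r (deg m T (s n) n ω) * fallWeight f r y₀ (deg m T (s n) i ω) ≤
      R / ((s n : ℝ) + 1) ^ 3
    calc riseWeight f r (deg m T (s n) n ω) * fallWeight f r y₀ (deg m T (s n) i ω)
        ≤ Real.exp (r * Phi f 1 (m n ω)) *
            Real.exp (-(r * (Phi f 1 (deg m T (s n) i ω) - Phi f 1 y₀))) := by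
          rw [hdn]
          exact mul_le_mul (riseWeight_le_exp hf_pos hr _) (fallWeight_le_exp hf_pos hy₀ h6)
            (fallWeight_pos hf_pos hy₀ _).le (Real.exp_pos _).le
      _ ≤ Real.exp (r * (R₀ + Phi f 1 y₀)) * Real.exp (-(3 * Real.log ((s n : ℝ) + 1))) := by
          rw [← Real.exp_add, ← Real.exp_add, Real.exp_le_exp]
          have h10 : 3 * Real.log ((s n : ℝ) + 1) =
              r * (Real.log ((s n : ℝ) + 1) / (6 * C) - Real.log ((s n : ℝ) + 1) / (7 * C)) := by
            rw [hr_def]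
            field_simp
            ring
          rw [h10]
          nlinarith [mul_le_mul_of_nonneg_left h8 hr.le, mul_le_mul_of_nonneg_left h9 hr.le]
      _ ≤ R / ((s n : ℝ) + 1) ^ 3 := by
          rw [hexp, mul_one_div]
          gcongr

end Late

/-! ### Two vertices tie only finitely often -/

section Ties

variable {f : ℕ → ℝ} {C : ℝ}

/-- The variance `∑_{l≥x} 1/f(l)²` that the future growth of a vertex of degree `x` contributes. -/
noncomputable def tailSum (f : ℕ → ℝ) (x : ℕ) : ℝ :=
  ∑' l, 1 / f (l + x) ^ 2

lemma tailSum_eq (hsum : Summable fun l => 1 / f l ^ 2) (x : ℕ) :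
    tailSum f x = (1 / f x) ^ 2 + tailSum f (x + 1) := by
  have h := ((summable_nat_add_iff x).2 hsum).tsum_eq_zero_add
  rw [tailSum, h, Nat.zero_add, one_div_pow, tailSum]
  simp only [add_assoc, add_comm 1 x]

lemma tailSum_nonneg (hf_pos : ∀ i, 0 < f i) (x : ℕ) : 0 ≤ tailSum f x :=
  tsum_nonneg fun l => by have := hf_pos (l + x); positivity

lemma sq_le_tailSum (hf_pos : ∀ i, 0 < f i) (hsum : Summable fun l => 1 / f l ^ 2) (x : ℕ) :
    (1 / f x) ^ 2 ≤ tailSum f x := by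
  rw [tailSum_eq hsum]
  linarith [tailSum_nonneg hf_pos (x + 1)]

lemma tailSum_pos (hf_pos : ∀ i, 0 < f i) (hsum : Summable fun l => 1 / f l ^ 2) (x : ℕ) :
    0 < tailSum f x :=
  lt_of_lt_of_le (by have := hf_pos x; positivity) (sq_le_tailSum hf_pos hsum x)

lemma tendsto_tailSum (f : ℕ → ℝ) : Tendsto (tailSum f) atTop (𝓝 0) :=
  tendsto_sum_nat_add fun l => 1 / f l ^ 2

/-- The conditional second moment of the limit of `Φ₁(x) - Φ₁(y)`, given the current degrees. -/
noncomputable def secondMoment (f : ℕ → ℝ) (x y : ℕ) : ℝ :=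
  (Phi f 1 x - Phi f 1 y) ^ 2 + (tailSum f x + tailSum f y)

/-- An upper bound for the conditional fourth moment of the limit of `Φ₁(x) - Φ₁(y)`. -/
noncomputable def fourthMoment (f : ℕ → ℝ) (x y : ℕ) : ℝ :=
  (Phi f 1 x - Phi f 1 y) ^ 4 + 7 * (Phi f 1 x - Phi f 1 y) ^ 2 * (tailSum f x + tailSum f y) +
    32 * (tailSum f x + tailSum f y) ^ 2

lemma secondMoment_nonneg (hf_pos : ∀ i, 0 < f i) (x y : ℕ) : 0 ≤ secondMoment f x y := by
  have := tailSum_nonneg hf_pos x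
  have := tailSum_nonneg hf_pos y
  unfold secondMoment
  positivity

lemma secondMoment_sq_le (hf_pos : ∀ i, 0 < f i) (x y : ℕ) :
    secondMoment f x y ^ 2 ≤ fourthMoment f x y := by
  have h1 := tailSum_nonneg hf_pos x
  have h2 := tailSum_nonneg hf_pos y
  unfold secondMoment fourthMoment
  set D := Phi f 1 x - Phi f 1 y
  set V := tailSum f x + tailSum f y
  have : 0 ≤ D ^ 2 * V := by positivity
  nlinarith [sq_nonneg V]

lemma secondMoment_self (f : ℕ → ℝ) (x : ℕ) : secondMoment f x x = 2 * tailSum f x := by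
  simp [secondMoment, two_mul]

lemma fourthMoment_self (f : ℕ → ℝ) (x : ℕ) :
    fourthMoment f x x = 32 * (2 * tailSum f x) ^ 2 := by
  simp [fourthMoment, two_mul]

lemma Phi_one_succ (f : ℕ → ℝ) (x : ℕ) : Phi f 1 (x + 1) = Phi f 1 x + 1 / f x := by
  rw [Phi, Finset.sum_range_succ, pow_one, Phi]

lemma secondMoment_drift (hf_pos : ∀ i, 0 < f i) (hsum : Summable fun l => 1 / f l ^ 2)
    (x y : ℕ) {s : ℝ} (hs : 0 < s) :
    secondMoment f x y + (secondMoment f (x + 1) y - secondMoment f x y) * (f x / s) +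
      (secondMoment f x (y + 1) - secondMoment f x y) * (f y / s) = secondMoment f x y := by
  have hx := hf_pos x
  have hy := hf_pos y
  have h1 : 1 / f x * (f x / s) = 1 / s := by field_simp
  have h2 : 1 / f y * (f y / s) = 1 / s := by field_simp
  have h3 := tailSum_eq hsum x
  have h4 := tailSum_eq hsum y
  unfold secondMoment
  rw [h3, h4, Phi_one_succ, Phi_one_succ]
  linear_combination (2 * (Phi f 1 x - Phi f 1 y)) * h1 - (2 * (Phi f 1 x - Phi f 1 y)) * h2

lemma fourthMoment_drift (hf_pos : ∀ i, 0 < f i) (hsum : Summable fun l => 1 / f l ^ 2)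
    (x y : ℕ) {s : ℝ} (hs : 0 < s) :
    fourthMoment f x y + (fourthMoment f (x + 1) y - fourthMoment f x y) * (f x / s) +
      (fourthMoment f x (y + 1) - fourthMoment f x y) * (f y / s) ≤ fourthMoment f x y := by
  have hx := hf_pos x
  have hy := hf_pos y
  have h1 : 1 / f x * (f x / s) = 1 / s := by field_simp
  have h2 : 1 / f y * (f y / s) = 1 / s := by field_simp
  have hu : 0 < 1 / f x := by positivity
  have hw : 0 < 1 / f y := by positivity
  have hq : 0 < 1 / s := by positivity
  have h3 : tailSum f (x + 1) = tailSum f x - (1 / f x) ^ 2 := by rw [tailSum_eq hsum x]; ring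
  have h4 : tailSum f (y + 1) = tailSum f y - (1 / f y) ^ 2 := by rw [tailSum_eq hsum y]; ring
  have hV : (1 / f x) ^ 2 + (1 / f y) ^ 2 ≤ tailSum f x + tailSum f y :=
    add_le_add (sq_le_tailSum hf_pos hsum x) (sq_le_tailSum hf_pos hsum y)
  have e1 : Phi f 1 x + 1 / f x - Phi f 1 y = (Phi f 1 x - Phi f 1 y) + 1 / f x := by ring
  have e2 : Phi f 1 x - (Phi f 1 y + 1 / f y) = (Phi f 1 x - Phi f 1 y) - 1 / f y := by ring
  have e3 : tailSum f x - (1 / f x) ^ 2 + tailSum f y =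
      (tailSum f x + tailSum f y) - (1 / f x) ^ 2 := by ring
  have e4 : tailSum f x + (tailSum f y - (1 / f y) ^ 2) =
      (tailSum f x + tailSum f y) - (1 / f y) ^ 2 := by ring
  unfold fourthMoment
  rw [Phi_one_succ, Phi_one_succ, h3, h4, e1, e2, e3, e4]
  generalize Phi f 1 x - Phi f 1 y = D
  generalize tailSum f x + tailSum f y = V at *
  generalize 1 / f x = u at *
  generalize 1 / f y = w at *
  generalize f x / s = p at *
  generalize f y / s = p' at *
  generalize 1 / s = q at *
  -- The brackets are `u` and `w` times polynomials, whose sum is nonpositive as `u² + w² ≤ V`.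
  have key : (D + u) ^ 4 + 7 * (D + u) ^ 2 * (V - u ^ 2) + 32 * (V - u ^ 2) ^ 2 -
        (D ^ 4 + 7 * D ^ 2 * V + 32 * V ^ 2) =
      u * (4 * D ^ 3 + 6 * D ^ 2 * u + 4 * D * u ^ 2 + u ^ 3 +
        7 * (2 * D * V + u * V - u * (D + u) ^ 2) + 32 * (u ^ 3 - 2 * u * V)) := by ring
  have key' : (D - w) ^ 4 + 7 * (D - w) ^ 2 * (V - w ^ 2) + 32 * (V - w ^ 2) ^ 2 -
        (D ^ 4 + 7 * D ^ 2 * V + 32 * V ^ 2) =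
      w * (-4 * D ^ 3 + 6 * D ^ 2 * w - 4 * D * w ^ 2 + w ^ 3 +
        7 * (-2 * D * V + w * V - w * (D - w) ^ 2) + 32 * (w ^ 3 - 2 * w * V)) := by ring
  rw [key, key']
  have hsumneg : (4 * D ^ 3 + 6 * D ^ 2 * u + 4 * D * u ^ 2 + u ^ 3 +
        7 * (2 * D * V + u * V - u * (D + u) ^ 2) + 32 * (u ^ 3 - 2 * u * V)) +
      (-4 * D ^ 3 + 6 * D ^ 2 * w - 4 * D * w ^ 2 + w ^ 3 +
        7 * (-2 * D * V + w * V - w * (D - w) ^ 2) + 32 * (w ^ 3 - 2 * w * V)) ≤ 0 := by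
    have a1 : 0 ≤ (u + w) * (D + 5 * (u - w)) ^ 2 := by positivity
    have a2 : 0 ≤ (u + w) * (V - (u ^ 2 + w ^ 2)) :=
      mul_nonneg (by positivity) (sub_nonneg.2 hV)
    have a3 : 0 ≤ (u + w) * (6 * (u ^ 2 + w ^ 2) + 76 * (u * w)) := by positivity
    linarith
  have hfin := mul_nonpos_of_nonneg_of_nonpos hq.le hsumneg
  linear_combination hfin +
    (4 * D ^ 3 + 6 * D ^ 2 * u + 4 * D * u ^ 2 + u ^ 3 +
        7 * (2 * D * V + u * V - u * (D + u) ^ 2) + 32 * (u ^ 3 - 2 * u * V)) * h1 +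
    (-4 * D ^ 3 + 6 * D ^ 2 * w - 4 * D * w ^ 2 + w ^ 3 +
        7 * (-2 * D * V + w * V - w * (D - w) ^ 2) + 32 * (w ^ 3 - 2 * w * V)) * h2

variable {Ω : Type*}

/-- The event that `v_i` and `v_j` have the same degree infinitely often. -/
def tieEvent (m T : ℕ → Ω → ℕ) (i j : ℕ) : Set Ω :=
  {ω | ∃ᶠ k in atTop, deg m T k i ω = deg m T k j ω}

variable [mΩ : MeasurableSpace Ω] {P : Measure Ω} {m T : ℕ → Ω → ℕ}

lemma measurableSet_tieEvent (h : IsAttachmentModel P f m T) (i j : ℕ) :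
    MeasurableSet[⨆ k, history m T k] (tieEvent m T i j) := by
  have : tieEvent m T i j = ⋂ N : ℕ, ⋃ k : ℕ, ⋃ _ : N ≤ k,
      {ω | deg m T k i ω = deg m T k j ω} := by
    ext ω
    simp only [Set.mem_iInter, Set.mem_iUnion, tieEvent, Set.mem_ofPred_eq, frequently_atTop]
    simp only [exists_prop]
  rw [this]
  refine MeasurableSet.iInter fun N => MeasurableSet.iUnion fun k =>
    MeasurableSet.iUnion fun _ => ?_
  refine le_iSup (history m T) k _ ?_
  exact measurableSet_eq_fun (measurable_deg h le_rfl i) (measurable_deg h le_rfl j)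

variable [IsProbabilityMeasure P]

/-- From a tie, two vertices tie only finitely often with a probability bounded away from zero:
the squared limit of the difference of their `Φ₁` has mean `V` and second moment at most `32V²`,
and it vanishes if there are infinitely many ties. -/
lemma le_measureReal_diff_tieEvent (h : IsAttachmentModel P f m T) (hf_pos : ∀ i, 0 < f i)
    (hf_mono : Monotone f) (hC : 0 < C) (hf_le : ∀ i : ℕ, f i ≤ C * ((i : ℝ) + 1))
    (hsum : Summable fun l => 1 / f l ^ 2) {i j : ℕ} (hij : i ≠ j) {k₀ a : ℕ} {B : Set Ω}
    (hB : MeasurableSet[history m T k₀] B)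
    (hBi : ∀ ω ∈ B, edgeTotal (fun j => m j ω) i ≤ k₀)
    (hBj : ∀ ω ∈ B, edgeTotal (fun j => m j ω) j ≤ k₀)
    (hai : ∀ ω ∈ B, deg m T k₀ i ω = a) (haj : ∀ ω ∈ B, deg m T k₀ j ω = a) :
    3 / 128 * P.real B ≤ P.real (B \ tieEvent m T i j) := by
  have hBm : MeasurableSet B := h.history_le k₀ _ hB
  have hA : MeasurableSet (tieEvent m T i j) :=
    (iSup_le h.history_le : ⨆ k, history m T k ≤ mΩ) _ (measurableSet_tieEvent h i j)
  set A := tieEvent m T i j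
  set V := 2 * tailSum f a
  have hVpos : 0 < V := by have := tailSum_pos hf_pos hsum a; positivity
  set X : ℕ → Ω → ℝ := fun n => B.indicator fun ω =>
    secondMoment f (deg m T (k₀ + n) i ω) (deg m T (k₀ + n) j ω) with hXdef
  set Y : ℕ → Ω → ℝ := fun n => B.indicator fun ω =>
    fourthMoment f (deg m T (k₀ + n) i ω) (deg m T (k₀ + n) j ω) with hYdef
  have hX : Supermartingale X (h.filtration k₀) P :=
    supermartingale_pair h hf_pos hC hf_le (y₀ := 0) hij hB hBi hBj (fun _ _ => Nat.zero_le _)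
      (fun _ => secondMoment f) fun _ x y _ s hs _ => (secondMoment_drift hf_pos hsum x y hs).le
  have hX' : Supermartingale (fun n => B.indicator fun ω =>
      -secondMoment f (deg m T (k₀ + n) i ω) (deg m T (k₀ + n) j ω)) (h.filtration k₀) P :=
    supermartingale_pair h hf_pos hC hf_le (y₀ := 0) hij hB hBi hBj (fun _ _ => Nat.zero_le _)
      (fun _ x y => -secondMoment f x y) fun _ x y _ s hs _ => by
        linarith [secondMoment_drift hf_pos hsum x y hs]
  have hY : Supermartingale Y (h.filtration k₀) P :=
    supermartingale_pair h hf_pos hC hf_le (y₀ := 0) hij hB hBi hBj (fun _ _ => Nat.zero_le _)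
      (fun _ => fourthMoment f) fun _ x y _ s hs _ => fourthMoment_drift hf_pos hsum x y hs
  have hXpos : ∀ n ω, 0 ≤ X n ω := fun n ω =>
    Set.indicator_nonneg (fun ω _ => secondMoment_nonneg hf_pos _ _) ω
  have hYsq : ∀ n ω, X n ω ^ 2 ≤ Y n ω := by
    intro n ω
    by_cases hω : ω ∈ B
    · simp only [hXdef, hYdef, Set.indicator_of_mem hω]
      exact secondMoment_sq_le hf_pos _ _
    · simp [hXdef, hYdef, Set.indicator_of_notMem hω]
  have hX0 : ∫ ω, X 0 ω ∂P = V * P.real B := by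
    have : X 0 = B.indicator fun _ => V := by
      refine Set.indicator_congr fun ω hω => ?_
      rw [Nat.add_zero, hai ω hω, haj ω hω, secondMoment_self]
    rw [this, integral_indicator_const _ hBm, smul_eq_mul, mul_comm]
  have hY0 : ∫ ω, Y 0 ω ∂P = 32 * V ^ 2 * P.real B := by
    have : Y 0 = B.indicator fun _ => 32 * V ^ 2 := by
      refine Set.indicator_congr fun ω hω => ?_
      rw [Nat.add_zero, hai ω hω, haj ω hω, fourthMoment_self]
    rw [this, integral_indicator_const _ hBm, smul_eq_mul, mul_comm]
  have hXn : ∀ n, V * P.real B ≤ ∫ ω, X n ω ∂P := by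
    intro n
    have h1 := hX'.setIntegral_le (Nat.zero_le n) MeasurableSet.univ
    have h2 : ∀ n ω, B.indicator (fun ω =>
        -secondMoment f (deg m T (k₀ + n) i ω) (deg m T (k₀ + n) j ω)) ω = -X n ω := by
      intro n ω
      simp only [hXdef, Set.indicator]
      split_ifs <;> simp
    simp only [Measure.restrict_univ, h2, integral_neg, neg_le_neg_iff] at h1
    exact hX0 ▸ h1
  have hYn : ∀ n, ∫ ω, Y n ω ∂P ≤ 32 * V ^ 2 * P.real B := by
    intro n
    have h1 := hY.setIntegral_le (Nat.zero_le n) MeasurableSet.univ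
    simp only [Measure.restrict_univ] at h1
    exact hY0 ▸ h1
  set t : ℝ := 32 * V with ht
  have htpos : 0 < t := by positivity
  set M : ℕ → Ω → ℝ := fun n => (B ∩ A).indicator fun ω => min (X n ω) t with hM
  have hMm : ∀ n, AEStronglyMeasurable (M n) P := fun n =>
    (((hX.integrable n).aestronglyMeasurable.inf aestronglyMeasurable_const)).indicator
      (hBm.inter hA)
  have hMb : ∀ n ω, ‖M n ω‖ ≤ t := by
    intro n ω
    rw [Real.norm_eq_abs, abs_of_nonneg (Set.indicator_nonneg
      (fun ω _ => le_min (hXpos n ω) htpos.le) ω)]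
    by_cases hω : ω ∈ B ∩ A
    · simp only [Set.indicator_of_mem hω]
      exact min_le_right _ _
    · simp only [Set.indicator_of_notMem hω]
      exact htpos.le
  -- On infinitely many ties, the convergent process `X` has the limit zero.
  have hMlim : Tendsto (fun n => ∫ ω, M n ω ∂P) atTop (𝓝 (∫ _, (0 : ℝ) ∂P)) := by
    refine tendsto_integral_of_dominated_convergence (fun _ => t) hMm (integrable_const t)
      (fun n => ae_of_all _ (hMb n)) ?_
    filter_upwards [ae_exists_tendsto_of_supermartingale hX hXpos,
      ae_tendsto_deg h hf_pos hf_mono hC hf_le i] with ω ⟨z, hz⟩ hdeg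
    by_cases hω : ω ∈ B ∩ A
    swap
    · simp only [hM, Set.indicator_of_notMem hω]
      exact tendsto_const_nhds
    have htail : Tendsto (fun n => 2 * tailSum f (deg m T (k₀ + n) i ω)) atTop (𝓝 0) := by
      have h1 : Tendsto (fun n => deg m T (k₀ + n) i ω) atTop atTop :=
        hdeg.comp (tendsto_atTop_mono (fun n => Nat.le_add_left n k₀) tendsto_id)
      simpa using ((tendsto_tailSum f).comp h1).const_mul 2
    have hz0 : z = 0 := by
      by_contra hne
      have h1 := (hz.sub htail).eventually_ne (by simpa using hne : z - 0 ≠ 0)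
      obtain ⟨N, hN⟩ := eventually_atTop.1 h1
      obtain ⟨k, hk, hkt⟩ := frequently_atTop.1
        (show ∃ᶠ k in atTop, deg m T k i ω = deg m T k j ω from hω.2) (k₀ + N)
      obtain ⟨n, rfl⟩ := Nat.exists_eq_add_of_le ((Nat.le_add_right k₀ N).trans hk)
      refine hN n (by omega) ?_
      simp only [hXdef, Set.indicator_of_mem hω.1]
      rw [← hkt, secondMoment_self, sub_self]
    rw [hz0] at hz
    have h2 : Tendsto (fun n => min (X n ω) t) atTop (𝓝 (min 0 t)) := hz.min tendsto_const_nhds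
    rw [min_eq_left htpos.le] at h2
    simpa only [hM, Set.indicator_of_mem hω] using h2
  have hbound : ∀ n, V * P.real B ≤
      t * P.real (B \ A) + ∫ ω, M n ω ∂P + V / 4 * P.real B := by
    intro n
    have hMi : Integrable (M n) P := Integrable.of_bound (hMm n) t (ae_of_all _ (hMb n))
    have hIi : Integrable ((B \ A).indicator fun _ => t) P :=
      (integrable_const t).indicator (hBm.diff hA)
    have hpt : ∀ ω, X n ω ≤ (B \ A).indicator (fun _ => t) ω + M n ω + Y n ω / (4 * t) := by
      intro ω
      have h1 : X n ω ≤ t + Y n ω / (4 * t) := by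
        have h2 : X n ω ^ 2 / (4 * t) ≤ Y n ω / (4 * t) := by gcongr; exact hYsq n ω
        have h3 : X n ω ≤ t + X n ω ^ 2 / (4 * t) := by
          rw [← sub_le_iff_le_add', le_div_iff₀ (by positivity)]
          nlinarith [sq_nonneg (X n ω - 2 * t)]
        linarith
      have h0 : 0 ≤ Y n ω / (4 * t) := by
        have := (sq_nonneg _).trans (hYsq n ω)
        positivity
      by_cases hωB : ω ∈ B
      · by_cases hωA : ω ∈ A
        · rw [Set.indicator_of_notMem (fun hc => hc.2 hωA)]
          simp only [hM, Set.indicator_of_mem (show ω ∈ B ∩ A from ⟨hωB, hωA⟩)]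
          rcases le_total (X n ω) t with hle | hle
          · rw [min_eq_left hle]
            linarith
          · rw [min_eq_right hle]
            linarith
        · rw [Set.indicator_of_mem (show ω ∈ B \ A from ⟨hωB, hωA⟩)]
          simp only [hM, Set.indicator_of_notMem (fun hc : ω ∈ B ∩ A => hωA hc.2)]
          linarith
      · have hX00 : X n ω = 0 := Set.indicator_of_notMem hωB _
        rw [Set.indicator_of_notMem (fun hc => hωB hc.1)]
        simp only [hM, Set.indicator_of_notMem (fun hc : ω ∈ B ∩ A => hωB hc.1)]
        linarith
    calc V * P.real B ≤ ∫ ω, X n ω ∂P := hXn n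
      _ ≤ ∫ ω, ((B \ A).indicator (fun _ => t) ω + M n ω + Y n ω / (4 * t)) ∂P :=
          integral_mono (hX.integrable n) ((hIi.add hMi).add ((hY.integrable n).div_const _)) hpt
      _ = t * P.real (B \ A) + ∫ ω, M n ω ∂P + (∫ ω, Y n ω ∂P) / (4 * t) := by
          have e1 : ∫ ω, ((B \ A).indicator (fun _ => t) ω + M n ω + Y n ω / (4 * t)) ∂P =
              ∫ ω, ((B \ A).indicator (fun _ => t) ω + M n ω) ∂P + ∫ ω, Y n ω / (4 * t) ∂P :=
            integral_add (hIi.add hMi) ((hY.integrable n).div_const _)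
          rw [e1, integral_add hIi hMi, integral_indicator_const _ (hBm.diff hA), integral_div,
            smul_eq_mul, mul_comm t]
      _ ≤ t * P.real (B \ A) + ∫ ω, M n ω ∂P + (32 * V ^ 2 * P.real B) / (4 * t) := by
          gcongr
          exact hYn n
      _ = _ := by
          rw [ht]
          field_simp
  have hlim := ge_of_tendsto' ((hMlim.const_add (t * P.real (B \ A))).add_const
    (V / 4 * P.real B)) hbound
  rw [integral_zero, add_zero, ht] at hlim
  have h5 : V * (3 / 4 * P.real B) ≤ V * (32 * P.real (B \ A)) := by linarith
  have h6 := le_of_mul_le_mul_left h5 hVpos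
  linarith

/-- Two vertices have the same degree only finitely often. By Lévy's upward theorem, the
conditional probability of infinitely many ties would tend to one on that event, whereas it is
bounded away from one at every tie. -/
lemma ae_eventually_deg_ne (h : IsAttachmentModel P f m T) (hf_pos : ∀ i, 0 < f i)
    (hf_mono : Monotone f) (hC : 0 < C) (hf_le : ∀ i : ℕ, f i ≤ C * ((i : ℝ) + 1))
    (hsum : Summable fun l => 1 / f l ^ 2) {i j : ℕ} (hij : i ≠ j) :
    ∀ᵐ ω ∂P, ∀ᶠ k in atTop, deg m T k i ω ≠ deg m T k j ω := by
  have hA' := measurableSet_tieEvent h i j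
  have hsup : ⨆ k, history m T k ≤ mΩ := iSup_le h.history_le
  set A := tieEvent m T i j
  have hA : MeasurableSet A := hsup _ hA'
  set g : Ω → ℝ := A.indicator fun _ => 1 with hg
  have hgi : Integrable g P := (integrable_const 1).indicator hA
  have hcond : ∀ k a : ℕ, ∀ᵐ ω ∂P, ¬ (ω ∈ {ω | edgeTotal (fun j => m j ω) i ≤ k} ∩
      {ω | edgeTotal (fun j => m j ω) j ≤ k} ∩ {ω | deg m T k i ω = a} ∩
      {ω | deg m T k j ω = a} ∩ {ω | 125 / 128 < P[g | history m T k] ω}) := by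
    intro k a
    set B : Set Ω := {ω | edgeTotal (fun j => m j ω) i ≤ k} ∩
      {ω | edgeTotal (fun j => m j ω) j ≤ k} ∩ {ω | deg m T k i ω = a} ∩
      {ω | deg m T k j ω = a} ∩ {ω | 125 / 128 < P[g | history m T k] ω} with hBdef
    have hB : MeasurableSet[history m T k] B := by
      refine MeasurableSet.inter (MeasurableSet.inter (MeasurableSet.inter (MeasurableSet.inter
        ?_ ?_) ?_) ?_) ?_
      · exact measurableSet_edgeTotal_le m T k k i
      · exact measurableSet_edgeTotal_le m T k k j
      · exact measurable_deg h le_rfl i (measurableSet_singleton a)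
      · exact measurable_deg h le_rfl j (measurableSet_singleton a)
      · exact stronglyMeasurable_condExp.measurable measurableSet_Ioi
    have hBm : MeasurableSet B := h.history_le k _ hB
    have h1 := le_measureReal_diff_tieEvent h hf_pos hf_mono hC hf_le hsum hij hB
      (fun ω hω => hω.1.1.1.1) (fun ω hω => hω.1.1.1.2) (fun ω hω => hω.1.1.2)
      (fun ω hω => hω.1.2)
    have h2 : ∫ ω in B, P[g | history m T k] ω ∂P = P.real (B ∩ A) := by
      rw [setIntegral_condExp (h.history_le k) hgi hB, hg, setIntegral_indicator hA,
        setIntegral_const, smul_eq_mul, mul_one]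
    have h3 : P.real (B ∩ A) + P.real (B \ A) = P.real B := measureReal_inter_add_sdiff hA
    have h4 : ∫ ω in B, (P[g | history m T k] ω - 125 / 128) ∂P ≤ 0 := by
      rw [integral_sub integrable_condExp.integrableOn (integrable_const _), h2,
        setIntegral_const, smul_eq_mul]
      linarith
    have h5 : ∀ ω ∈ B, 0 < P[g | history m T k] ω - 125 / 128 := fun ω hω => sub_pos.2 hω.2
    have h6 : 0 ≤ ∫ ω in B, (P[g | history m T k] ω - 125 / 128) ∂P :=
      setIntegral_nonneg hBm fun ω hω => (h5 ω hω).le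
    have h7 := (setIntegral_eq_zero_iff_of_nonneg_ae
      ((ae_restrict_iff' hBm).2 (ae_of_all _ fun ω hω => (h5 ω hω).le))
      (integrable_condExp.sub (integrable_const _)).integrableOn).1 (le_antisymm h4 h6)
    filter_upwards [(ae_restrict_iff' hBm).1 h7] with ω hω hωB
    exact (h5 ω hωB).ne' (hω hωB)
  have hlevy := tendsto_ae_condExp (μ := P) (ℱ := h.filtration 0) g
  have hcongr : ⨆ n, (h.filtration 0) n = ⨆ k, history m T k := by
    refine iSup_congr fun n => ?_
    change history m T (0 + n) = _
    rw [Nat.zero_add]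
  rw [hcongr, condExp_of_stronglyMeasurable hsup (stronglyMeasurable_const.indicator hA') hgi]
    at hlevy
  filter_upwards [hlevy, ae_all_iff.2 fun k => ae_all_iff.2 fun a => hcond k a] with ω hω hω2
  by_contra hcon
  have hωA : ω ∈ A := by
    rw [not_eventually] at hcon
    exact hcon.mono fun k hk => not_not.1 hk
  have hfreq : ∃ᶠ n in atTop, P[g | (h.filtration 0) n] ω ≤ 125 / 128 := by
    have h1 : ∃ᶠ k in atTop, deg m T k i ω = deg m T k j ω := hωA
    refine (h1.and_eventually ((eventually_ge_atTop (edgeTotal (fun j => m j ω) i)).and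
      (eventually_ge_atTop (edgeTotal (fun j => m j ω) j)))).mono ?_
    rintro k ⟨h2, h3, h4⟩
    have h5 : P[g | history m T k] ω ≤ 125 / 128 := by
      by_contra h6
      exact hω2 k _ ⟨⟨⟨⟨h3, h4⟩, rfl⟩, h2.symm⟩, not_le.1 h6⟩
    change P[g | history m T (0 + k)] ω ≤ _
    rwa [Nat.zero_add]
  have := le_of_tendsto_of_frequently hω hfreq
  rw [Set.indicator_of_mem hωA] at this
  norm_num at this

end Ties

/-! ### Persistence of the highest degrees -/

section Persistence

/-- Two counters of which at most one grows at each step cannot change their order without a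
tie. -/
lemma order_of_ne {a b : ℕ → ℕ} {k₀ : ℕ} (hne : ∀ k ≥ k₀, a k ≠ b k)
    (ha : ∀ k ≥ k₀, a k ≤ a (k + 1)) (hb : ∀ k ≥ k₀, b k ≤ b (k + 1))
    (hab : ∀ k ≥ k₀, a (k + 1) + b (k + 1) ≤ a k + b k + 1) :
    (∀ k ≥ k₀, a k < b k) ∨ ∀ k ≥ k₀, b k < a k := by
  rcases lt_or_gt_of_ne (hne k₀ le_rfl) with h | h
  · left
    intro k hk
    induction k, hk using Nat.le_induction with
    | base => exact h
    | succ k hk ih =>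
      have := hne (k + 1) (by omega)
      have := ha k hk
      have := hb k hk
      have := hab k hk
      omega
  · right
    intro k hk
    induction k, hk using Nat.le_induction with
    | base => exact h
    | succ k hk ih =>
      have := hne (k + 1) (by omega)
      have := ha k hk
      have := hb k hk
      have := hab k hk
      omega

lemma exists_top_subset (w : ℕ → ℕ) {A : Finset ℕ} (hw : Set.InjOn w A) (K : ℕ)
    (hK : K ≤ A.card) :
    ∃ S ⊆ A, S.card = K ∧ ∀ i ∈ S, ∀ j ∈ A \ S, w j < w i := by
  induction K with
  | zero => exact ⟨∅, by simp⟩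
  | succ K ih =>
    obtain ⟨S, hSA, hcard, hS⟩ := ih (by omega)
    have hne : (A \ S).Nonempty := by
      rw [← Finset.card_pos, Finset.card_sdiff_of_subset hSA]
      omega
    obtain ⟨a, ha, hmax⟩ := Finset.exists_max_image (A \ S) w hne
    rw [Finset.mem_sdiff] at ha
    refine ⟨insert a S, Finset.insert_subset ha.1 hSA, ?_, fun i hi j hj => ?_⟩
    · rw [Finset.card_insert_of_notMem ha.2, hcard]
    · rw [Finset.mem_sdiff, Finset.mem_insert, not_or] at hj
      have hjS : j ∈ A \ S := Finset.mem_sdiff.2 ⟨hj.1, hj.2.2⟩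
      rcases Finset.mem_insert.1 hi with rfl | hi
      · exact lt_of_le_of_ne (hmax j hjS) fun h => hj.2.1 (hw hj.1 ha.1 h)
      · exact hS i hi j hjS

/-- The conclusion of the theorem for a fixed realization, from time `N` on. -/
def IsPersistentFrom (m T : ℕ → ℕ) (K N : ℕ) (S : Finset ℕ) : Prop :=
  (∀ n ≥ N, IsTopSet m T n K S) ∧
    (∀ n ≥ N, ∀ i ∈ S, ∀ j ∈ S, i ≠ j → graphDegree m T n i ≠ graphDegree m T n j) ∧
    ∀ n ≥ N, ∀ n' ≥ N, ∀ i ∈ S, ∀ j ∈ S,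
      (graphDegree m T n i < graphDegree m T n j ↔ graphDegree m T n' i < graphDegree m T n' j)

/-- If any two vertices eventually keep their order, and all but finitely many vertices stay below
any given vertex, then the highest degrees persist. The vertices of highest degree are then found
among the finitely many that do not stay below each of `v_0, …, v_{K-1}`. -/
lemma exists_isPersistentFrom {m T : ℕ → ℕ}
    (horder : ∀ i j, i ≠ j → (∀ᶠ n in atTop, graphDegree m T n i < graphDegree m T n j) ∨
      ∀ᶠ n in atTop, graphDegree m T n j < graphDegree m T n i)
    (hlate : ∀ i, ∀ᶠ v in atTop, ∀ n ≥ v, graphDegree m T n v < graphDegree m T n i) (K : ℕ) :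
    ∃ N S, IsPersistentFrom m T K N S := by
  obtain ⟨M₀, hM₀⟩ := eventually_atTop.1
    ((Finset.range K).eventually_all.2 fun i _ => hlate i)
  set M := max M₀ K with hM
  have hstable : ∀ᶠ N in atTop, ∀ p ∈ Finset.range M ×ˢ Finset.range M, p.1 ≠ p.2 →
      (∀ n ≥ N, graphDegree m T n p.1 < graphDegree m T n p.2) ∨
        ∀ n ≥ N, graphDegree m T n p.2 < graphDegree m T n p.1 := by
    refine (Finset.eventually_all _).2 fun p _ => ?_
    by_cases hp : p.1 = p.2
    · exact Eventually.of_forall fun _ h => absurd hp h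
    · rcases horder _ _ hp with h | h
      · exact (eventually_forall_ge_atTop.2 h).mono fun _ hN _ => Or.inl hN
      · exact (eventually_forall_ge_atTop.2 h).mono fun _ hN _ => Or.inr hN
  obtain ⟨N, hN, hNM⟩ := (hstable.and (eventually_ge_atTop M)).exists
  have hinj : Set.InjOn (graphDegree m T N) (Finset.range M : Finset ℕ) := by
    intro i hi j hj hij
    by_contra hne
    rcases hN (i, j) (Finset.mk_mem_product hi hj) hne with h | h
    · exact (h N le_rfl).ne hij
    · exact (h N le_rfl).ne' hij
  obtain ⟨S, hSM, hcard, hS⟩ := exists_top_subset (graphDegree m T N) hinj K (by simp [hM])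
  have hiff : ∀ i ∈ Finset.range M, ∀ j ∈ Finset.range M, ∀ n ≥ N,
      (graphDegree m T n i < graphDegree m T n j ↔
        graphDegree m T N i < graphDegree m T N j) := by
    intro i hi j hj n hn
    rcases eq_or_ne i j with rfl | hne
    · simp
    rcases hN (i, j) (Finset.mk_mem_product hi hj) hne with h | h
    · exact iff_of_true (h n hn) (h N le_rfl)
    · exact iff_of_false (h n hn).not_gt (h N le_rfl).not_gt
  refine ⟨N, S, fun n hn => ⟨fun i hi => ?_, hcard, fun i hi j hj => ?_⟩,
    fun n hn i hi j hj hne => ?_,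
    fun n hn n' hn' i hi j hj => ?_⟩
  · have := Finset.mem_range.1 (hSM hi)
    exact Finset.mem_range.2 (by omega)
  · rw [Finset.mem_sdiff, Finset.mem_range] at hj
    by_cases hjM : j < M
    · have hjM' := Finset.mem_range.2 hjM
      exact (hiff j hjM' i (hSM hi) n hn).2 (hS i hi j (Finset.mem_sdiff.2 ⟨hjM', hj.2⟩))
    · obtain ⟨i₀, hi₀K, hi₀⟩ : ∃ i₀ < K, graphDegree m T n i₀ ≤ graphDegree m T n i := by
        by_cases hiK : i < K
        · exact ⟨i, hiK, le_rfl⟩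
        · have : ¬ Finset.range K ⊆ S := fun hsub => by
            have := Finset.eq_of_subset_of_card_le hsub (by simp [hcard])
            exact hiK (Finset.mem_range.1 (this ▸ hi))
          obtain ⟨i₀, h1, h2⟩ := Finset.not_subset.1 this
          have h3 : i₀ ∈ Finset.range M :=
            Finset.mem_range.2 ((Finset.mem_range.1 h1).trans_le (le_max_right _ _))
          exact ⟨i₀, Finset.mem_range.1 h1,
            ((hiff i₀ h3 i (hSM hi) n hn).2 (hS i hi i₀ (Finset.mem_sdiff.2 ⟨h3, h2⟩))).le⟩
      exact (hM₀ j (by omega) i₀ (Finset.mem_range.2 hi₀K) n (by omega)).trans_le hi₀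
  · rcases hN (i, j) (Finset.mk_mem_product (hSM hi) (hSM hj)) hne with h | h
    · exact (h n hn).ne
    · exact (h n hn).ne'
  · rw [hiff i (hSM hi) j (hSM hj) n hn, hiff i (hSM hi) j (hSM hj) n' hn']

variable {Ω : Type*} [mΩ : MeasurableSpace Ω]

lemma measurable_comp_index {F : ℕ → Ω → ℕ} (hF : ∀ k, Measurable (F k)) {s : Ω → ℕ}
    (hs : Measurable s) : Measurable fun ω => F (s ω) ω :=
  (measurable_from_prod_countable_right (f := fun p : ℕ × Ω => F p.1 p.2) hF).comp
    (hs.prodMk measurable_id)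

variable {P : Measure Ω} {f : ℕ → ℝ} {m T : ℕ → Ω → ℕ}

lemma measurable_graphDegree (h : IsAttachmentModel P f m T) (n i : ℕ) :
    Measurable fun ω => graphDegree (fun j => m j ω) (fun l => T l ω) n i := by
  have h1 : Measurable fun ω => edgeTotal (fun j => m j ω) n :=
    (measurable_history_edgeTotal m T 0 n).mono (h.history_le 0) le_rfl
  have h2 : ∀ k, Measurable (deg m T k i) := fun k =>
    (measurable_deg h le_rfl i).mono (h.history_le k) le_rfl
  exact measurable_comp_index h2 h1

lemma measurableSet_isPersistentFrom (h : IsAttachmentModel P f m T) (K N : ℕ) :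
    MeasurableSet {ω | ∃ S, IsPersistentFrom (fun j => m j ω) (fun l => T l ω) K N S} := by
  have hlt : ∀ n i j, Measurable fun ω =>
      graphDegree (fun j => m j ω) (fun l => T l ω) n i <
        graphDegree (fun j => m j ω) (fun l => T l ω) n j := fun n i j =>
    Measurable.lt (measurable_graphDegree h n i) (measurable_graphDegree h n j)
  have hne : ∀ n i j, Measurable fun ω =>
      graphDegree (fun j => m j ω) (fun l => T l ω) n i ≠
        graphDegree (fun j => m j ω) (fun l => T l ω) n j := fun n i j =>
    (Measurable.eq (measurable_graphDegree h n i) (measurable_graphDegree h n j)).not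
  refine measurableSet_setOfPred.2 (Measurable.exists fun S => ?_)
  refine Measurable.and ?_ (Measurable.and ?_ ?_)
  · refine Measurable.forall fun n => measurable_const.imp (measurable_const.and
      (measurable_const.and ?_))
    exact Measurable.forall fun i => measurable_const.imp (Measurable.forall fun j =>
      measurable_const.imp (hlt n j i))
  · exact Measurable.forall fun n => measurable_const.imp (Measurable.forall fun i =>
      measurable_const.imp (Measurable.forall fun j => measurable_const.imp
        (measurable_const.imp (hne n i j))))
  · exact Measurable.forall fun n => measurable_const.imp (Measurable.forall fun n' =>
      measurable_const.imp (Measurable.forall fun i => measurable_const.imp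
        (Measurable.forall fun j => measurable_const.imp ((hlt n i j).iff (hlt n' i j)))))

end Persistence

end PrefAttach

theorem corollary4p2 {Ω : Type*} [MeasurableSpace Ω] (P : Measure Ω) [IsProbabilityMeasure P]
    (f : ℕ → ℝ) (hf_pos : ∀ i, 0 < f i) (hf_mono : Monotone f)
    (C : ℝ) (hC : 0 < C) (hf_le : ∀ i : ℕ, f i ≤ C * ((i : ℝ) + 1))
    (hPhi2 : ∃ L : ℝ, Tendsto (PrefAttach.Phi f 2) atTop (𝓝 L))
    (m T : ℕ → Ω → ℕ) (hmodel : PrefAttach.IsAttachmentModel P f m T)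
    (hedge : ∀ᵐ ω ∂P,
      limsup (fun n : ℕ =>
        ((PrefAttach.Phi f 1 (m n ω) /
          Real.log (PrefAttach.edgeTotal (fun j => m j ω) n : ℝ) : ℝ) : EReal)) atTop
        ≤ ((1 / (8 * C) : ℝ) : EReal))
    (K : ℕ) :
    ∃ N : Ω → ℕ, Measurable N ∧ ∀ᵐ ω ∂P, ∃ S : Finset ℕ,
      (∀ n ≥ N ω, PrefAttach.IsTopSet (fun j => m j ω) (fun l => T l ω) n K S) ∧
      (∀ n ≥ N ω, ∀ i ∈ S, ∀ j ∈ S, i ≠ j →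
        PrefAttach.graphDegree (fun j => m j ω) (fun l => T l ω) n i ≠
          PrefAttach.graphDegree (fun j => m j ω) (fun l => T l ω) n j) ∧
      (∀ n ≥ N ω, ∀ n' ≥ N ω, ∀ i ∈ S, ∀ j ∈ S,
        (PrefAttach.graphDegree (fun j => m j ω) (fun l => T l ω) n i <
            PrefAttach.graphDegree (fun j => m j ω) (fun l => T l ω) n j ↔
          PrefAttach.graphDegree (fun j => m j ω) (fun l => T l ω) n' i <
            PrefAttach.graphDegree (fun j => m j ω) (fun l => T l ω) n' j)) := by
  classical
  have hsum := PrefAttach.summable_one_div_sq hf_pos hPhi2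
  have hae : ∀ᵐ ω ∂P, ∃ N S,
      PrefAttach.IsPersistentFrom (fun j => m j ω) (fun l => T l ω) K N S := by
    have hties : ∀ᵐ ω ∂P, ∀ i j, i ≠ j → ∀ᶠ k in atTop,
        PrefAttach.deg m T k i ω ≠ PrefAttach.deg m T k j ω := by
      refine ae_all_iff.2 fun i => ae_all_iff.2 fun j => ?_
      by_cases hij : i = j
      · exact ae_of_all _ fun _ h => absurd hij h
      · filter_upwards [PrefAttach.ae_eventually_deg_ne hmodel hf_pos hf_mono hC hf_le hsum hij]
          with ω hω _ using hω
    filter_upwards [hties, ae_all_iff.2 fun i => PrefAttach.ae_eventually_deg_lt hmodel hf_pos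
      hf_mono hC hf_le hsum hedge i] with ω hω hlate
    have hs := PrefAttach.edgeTotal_strictMono (hmodel.one_le ω)
    refine PrefAttach.exists_isPersistentFrom (fun i j hij => ?_) (fun i => ?_) K
    · obtain ⟨k₀, hk₀⟩ := eventually_atTop.1 ((hω i j hij).and
        ((eventually_ge_atTop (PrefAttach.edgeTotal (fun j => m j ω) i)).and
          (eventually_ge_atTop (PrefAttach.edgeTotal (fun j => m j ω) j))))
      have hord := PrefAttach.order_of_ne (a := fun k => PrefAttach.deg m T k i ω)
        (b := fun k => PrefAttach.deg m T k j ω) (fun k hk => (hk₀ k hk).1)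
        (fun k _ => PrefAttach.deg_mono m T i ω (Nat.le_succ k))
        (fun k _ => PrefAttach.deg_mono m T j ω (Nat.le_succ k)) (fun k hk => by
          simp only [PrefAttach.deg_succ hmodel (hk₀ k hk).2.1,
            PrefAttach.deg_succ hmodel (hk₀ k hk).2.2]
          split_ifs <;> omega)
      rcases hord with h | h
      · exact Or.inl ((hs.tendsto_atTop.eventually (eventually_ge_atTop k₀)).mono
          fun n hn => h _ hn)
      · exact Or.inr ((hs.tendsto_atTop.eventually (eventually_ge_atTop k₀)).mono
          fun n hn => h _ hn)
    · exact (hlate i).mono fun v hv n hn => hv _ (hs.monotone hn)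
  -- On the exceptional null set, the time is set to zero to make it a total measurable function.
  set p : Ω → ℕ → Prop := fun ω N =>
    (∃ S, PrefAttach.IsPersistentFrom (fun j => m j ω) (fun l => T l ω) K N S) ∨
      ¬ ∃ N S, PrefAttach.IsPersistentFrom (fun j => m j ω) (fun l => T l ω) K N S
  have hp : ∀ ω, ∃ N, p ω N := fun ω => by
    by_cases hω : ∃ N S, PrefAttach.IsPersistentFrom (fun j => m j ω) (fun l => T l ω) K N S
    · obtain ⟨N, hN⟩ := hω
      exact ⟨N, Or.inl hN⟩
    · exact ⟨0, Or.inr hω⟩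
  have hmeas : ∀ N, MeasurableSet
      {ω | ∃ S, PrefAttach.IsPersistentFrom (fun j => m j ω) (fun l => T l ω) K N S} :=
    PrefAttach.measurableSet_isPersistentFrom hmodel K
  refine ⟨fun ω => Nat.find (hp ω), measurable_find hp fun N => ?_, ?_⟩
  · exact measurableSet_setOfPred.2 (Measurable.or (measurableSet_setOfPred.1 (hmeas N))
      (Measurable.exists fun N => measurableSet_setOfPred.1 (hmeas N)).not)
  · filter_upwards [hae] with ω hω
    exact (Nat.find_spec (hp ω)).resolve_right (not_not.2 hω)
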